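/- Let $\nu\ge 2$. For integers $k_1,\dots,k_\nu>1$ and positive numbers $\beta_{ij}$ ($1\le i\le\nu$, $1\le j\le k_i$) with $\sum_j\beta_{ij}=N$ for every $i$, let $P\subset\mathbb R^{k_1\cdots k_\nu}$ be the $\nu$-index transportation polytope of non-negative $k_1\times\dots\times k_\nu$ arrays $x=(\xi_{j_1\dots j_\nu})$ satisfying the equations $$\sum_{(j_1,\dots,j_\nu):\,j_i=j}\xi_{j_1\dots j_\nu}=\beta_{ij}\quad(1\le i\le\nu,\ 1\le j\le k_i-1),\qquad \sum_{j_1,\dots,j_\nu}\xi_{j_1\dots j_\nu}=N .$$ Let $A$ be the matrix of this system. It has $d=k_1+\dots+k_\nu-\nu+1$ rows; denote its columns by $a_J$, $J=(j_1,\dots,j_\nu)$. Let $z=(\zeta_J)$ be the point of $P$ maximizing $f(x)=k_1\cdots k_\nu+\sum_J\ln\xi_J$ on $P$ (where $\ln 0=-\infty$), let $B$ be the matrix with columns $\zeta_Ja_J$, and let $q(t)=\frac12\sum_J\zeta_J^2\langle a_J,t\rangle^2$ for $t\in\mathbb R^d$. Write $\operatorname{vol}P$ for the $(k_1\cdots k_\nu-d)$-dimensional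 volume of $P$ with respect to the Lebesgue measure induced on its affine hull by the Euclidean structure of $\mathbb R^{k_1\cdots k_\nu}$. Fix real numbers $a,b,\delta,\Delta$ with $a,\delta>0$. For a positive integer $n$, let $\mathcal P_n$ be the class of all such polytopes $P$ with $an\le k_i\le bn$ for all $i$ and $\delta\le\zeta_J\le\Delta$ for all $J$. (1) There are constants $c,C>0$, depending only on $\nu,a,b,\delta,\Delta$, such that for every $n$ and every $P\in\mathcal P_n$ the smallest eigenvalue $\lambda$ of $q$ satisfies $c\,n^{\nu-2}\le\lambda\le C\,n^{\nu-2}$. (2) If $\nu\ge5$, then the Gaussian formula $$G(P)=\frac1{(2\pi)^{d/2}}\left(\frac{\det AA^T}{\det BB^T}\right)^{1/2}e^{f(z)}$$ gives the volume with relative error tending to $0$, uniformly: for every $\varepsilon>0$ there is $n_0$ such that $|G(P)-\operatorname{vol}P|\le\varepsilon\operatorname{vol}P$ for all $n\ge n_0$ and all $P\in\mathcal P_n$. (3) Let $P_k$ be the dilated polytope of polystochastic tensors, that is, of $k\times\dots\times k$ ($\nu$ factors) arrays of non-negative numbers with all sums along the coordinate hyperplanes $\{j_i=j\}$ equal to $k^{\nu-1}$.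 For every $k>1$ the array with all entries $1$ maximizes $\sum_J\ln\xi_J$ on $P_k$, and, if $\nu\ge5$, $$\operatorname{vol}P_k=(1+o(1))\,\frac{e^{k^\nu}}{(2\pi)^{(\nu k-\nu+1)/2}}\qquad\text{as }k\to+\infty .$$ -/

import Mathlib

open MeasureTheory Filter Topology Matrix

noncomputable section

namespace GaussVol

section General

variable {R ι : Type*} [Fintype R] [Fintype ι]

/-- The polyhedron `{x : A x = b, x ≥ 0}` in the Euclidean space of vectors indexed by `ι`. -/
def polyhedron (A : Matrix R ι ℝ) (b : R → ℝ) : Set (EuclideanSpace ℝ ι) :=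
  {x | (∀ r, ∑ j, A r j * x j = b r) ∧ ∀ j, 0 ≤ x j}

/-- The entropy function `f(x) = n + ∑ ln ξ_j`, with `n` the number of coordinates. -/
def entropy (x : EuclideanSpace ℝ ι) : ℝ :=
  Fintype.card ι + ∑ j, Real.log (x j)

/-- `z` maximizes `f(x) = n + ∑ ln ξ_j` on `P`. Since `ln 0 = -∞`, the points of `P` with a zero
coordinate do not compete; they are left out because `Real.log 0 = 0`. -/
def IsAnalyticCenter (P : Set (EuclideanSpace ℝ ι)) (z : EuclideanSpace ℝ ι) : Prop :=
  z ∈ P ∧ (∀ j, 0 < z j) ∧ ∀ x ∈ P, (∀ j, 0 < x j) → entropy x ≤ entropy z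

/-- The matrix `B` with columns `ζ_j a_j`, where `a_j` are the columns of `A`. -/
def scaledMatrix (A : Matrix R ι ℝ) (z : EuclideanSpace ℝ ι) : Matrix R ι ℝ :=
  Matrix.of fun r j => z j * A r j

/-- The quadratic form `q(t) = (1/2) ∑ ζ_j² ⟨a_j, t⟩²`. -/
def momentForm (A : Matrix R ι ℝ) (z : EuclideanSpace ℝ ι) : QuadraticForm ℝ (R → ℝ) :=
  ∑ j, (z j ^ 2 / 2) •
    QuadraticMap.linMulLin (LinearMap.proj j ∘ₗ Aᵀ.mulVecLin) (LinearMap.proj j ∘ₗ Aᵀ.mulVecLin)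

theorem momentForm_apply (A : Matrix R ι ℝ) (z : EuclideanSpace ℝ ι) (t : R → ℝ) :
    momentForm A z t = 1 / 2 * ∑ j, z j ^ 2 * (∑ r, A r j * t r) ^ 2 := by
  simp only [momentForm, _root_.sum_apply, _root_.smul_apply, smul_eq_mul]
  rw [Finset.mul_sum]
  refine Finset.sum_congr rfl fun j _ => ?_
  have h : (LinearMap.proj j ∘ₗ Aᵀ.mulVecLin : (R → ℝ) →ₗ[ℝ] ℝ) t = ∑ r, A r j * t r := rfl
  rw [QuadraticMap.linMulLin_apply, h]
  ring

/-- `l` is the smallest eigenvalue of the quadratic form `Q`, that is, of its symmetric Gram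
matrix in the standard basis. -/
def IsSmallestEigenvalue [DecidableEq R] (Q : QuadraticForm ℝ (R → ℝ)) (l : ℝ) : Prop :=
  IsLeast {μ : ℝ | Module.End.HasEigenvalue (Matrix.toLin' Q.toMatrix') μ} l

/-- The Gaussian formula `(2π)^{-d/2} (det A Aᵀ / det B Bᵀ)^{1/2} e^{f(z)}`, with `d` the number of
rows of `A`. -/
def gaussianFormula [DecidableEq R] (A : Matrix R ι ℝ) (z : EuclideanSpace ℝ ι) : ℝ :=
  1 / (2 * Real.pi) ^ ((Fintype.card R : ℝ) / 2) *
    Real.sqrt ((A * Aᵀ).det / (scaledMatrix A z * (scaledMatrix A z)ᵀ).det) *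
    Real.exp (entropy z)

/-- The `m`-dimensional Euclidean volume of a subset of a Euclidean space. On an `m`-dimensional
affine subspace this is the induced Lebesgue measure. -/
def vol (m : ℕ) (S : Set (EuclideanSpace ℝ ι)) : ℝ :=
  (μHE[m] S).toReal

end General

/-- The positions `(j_1, …, j_ν)` in a `k_1 × … × k_ν` array. -/
abbrev Cell {ν : ℕ} (k : Fin ν → ℕ) : Type := (i : Fin ν) → Fin (k i)

/-- The equations of a transportation polytope: `some ⟨i, j⟩` is the `j`-th sectional sum in
direction `i`, for all `j` but the last one; `none` is the total sum. -/
abbrev Eqn {ν : ℕ} (k : Fin ν → ℕ) : Type :=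
  Option ((i : Fin ν) × {j : Fin (k i) // (j : ℕ) + 1 < k i})

/-- The matrix of the system: sectional sums and the total sum. -/
def sectionMatrix {ν : ℕ} (k : Fin ν → ℕ) : Matrix (Eqn k) (Cell k) ℝ :=
  Matrix.of fun e J =>
    match e with
    | none => 1
    | some ⟨i, j⟩ => if J i = j.1 then 1 else 0

/-- The right hand side of the system. -/
def sectionRhs {ν : ℕ} (k : Fin ν → ℕ) (N : ℝ) (β : (i : Fin ν) → Fin (k i) → ℝ) : Eqn k → ℝ
  | none => N
  | some ⟨i, j⟩ => β i j.1

/-- The `ν`-index transportation polytope of nonnegative `k_1 × … × k_ν` arrays with sectional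
sums `β i j` and total sum `N`. -/
def transportPolytope {ν : ℕ} (k : Fin ν → ℕ) (N : ℝ) (β : (i : Fin ν) → Fin (k i) → ℝ) :
    Set (EuclideanSpace ℝ (Cell k)) :=
  polyhedron (sectionMatrix k) (sectionRhs k N β)

/-- The dilated polytope of polystochastic tensors: nonnegative `k × … × k` arrays (`ν` indices)
all of whose sums along coordinate hyperplanes are `k ^ (ν - 1)`. -/
def polystochastic (ν k : ℕ) : Set (EuclideanSpace ℝ (Fin ν → Fin k)) :=
  {x | (∀ J, 0 ≤ x J) ∧
    ∀ (i : Fin ν) (j : Fin k),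
      ∑ J ∈ Finset.univ.filter (fun J : Fin ν → Fin k => J i = j), x J = (k : ℝ) ^ (ν - 1)}

end GaussVol

end

/-! Let X have independent exponential coordinates with means ζ_J. The first order condition at the
maximum z makes ∑ x_J/ζ_J constant on {Ax = b}, so the density of X equals e^{-f(z)} on all of P
(`sliceDensity_eq_vol`). Thus vol P is e^{f(z)} √det AAᵀ times the density of AX at its mean b.
Fourier inversion turns that density into the integral of ∏ e^{iu_J}/(1 + iu_J) with u_J = 2π ζ_J
⟨a_J, ξ⟩ (`vol_polyhedron_eq_integral`). Replacing the product by the Gaussian e^{-Q}, Q = ½ ∑ u_J²,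
gives exactly the Gaussian formula.

The error is controlled by one number κ with u_J² ≤ κQ for all J. Concavity of the logarithm gives
|∏ e^{iu_J}/(1 + iu_J)| ≤ (1 + κQ)^{-1/κ} on the whole space, so no separation of small and large ξ
is needed, and a Taylor expansion bounds the difference from e^{-Q} by ∑ |u_J|³ (1 + κQ)^{-1/κ}. The
last power is a Gamma mixture of Gaussians; comparing moments costs a factor (1 - pκ)^{-p} with p =
(d + 3)/2, and the Gaussian third moment of |u_J| is O(κ^{3/2}). This is
`norm_integral_charProd_sub_le`.

For the section matrix, ⟨a_J, t⟩ = c + ∑ g_i(j_i) with centered g_i. The terms are orthogonal over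
the set of cells (`sum_pi_sq_eq`), so everything reduces to comparing c² and ∑_j g_i(j)² with
different weights. This gives the lower eigenvalue bound, and κ = O(n^{1-ν}). The relative error is
then of order n^ν κ^{3/2} = n^{(3-ν)/2}, with p²κ = O(n^{3-ν}). The upper eigenvalue bound comes
from a test vector supported on one direction and the total. For polystochastic tensors z = 1 and B
= A, so the determinants cancel. -/

noncomputable section

namespace GaussVol

/-! ### Scalar inequalities: logarithmic characteristic function, Bernoulli, Gamma function. -/

section Scalar

/-- The logarithm of the characteristic function at `-u` of a centered exponential variable of
mean `1`. -/
def logChar (u : ℝ) : ℂ := Complex.I * u - Complex.log (1 + Complex.I * u)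

theorem one_add_I_mul_mem_slitPlane (u : ℝ) : (1 + Complex.I * u : ℂ) ∈ Complex.slitPlane := by
  left
  simp

theorem one_add_I_mul_ne_zero (u : ℝ) : (1 + Complex.I * u : ℂ) ≠ 0 :=
  Complex.slitPlane_ne_zero (one_add_I_mul_mem_slitPlane u)

theorem norm_one_add_I_mul (u : ℝ) : ‖(1 + Complex.I * u : ℂ)‖ = Real.sqrt (1 + u ^ 2) := by
  rw [Complex.norm_def, Complex.normSq_apply]
  congr 1
  simp
  ring

theorem exp_logChar (u : ℝ) :
    Complex.exp (logChar u) = Complex.exp (Complex.I * u) / (1 + Complex.I * u) := by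
  rw [logChar, Complex.exp_sub, Complex.exp_log (one_add_I_mul_ne_zero u)]

theorem logChar_re (u : ℝ) : (logChar u).re = -(Real.log (1 + u ^ 2) / 2) := by
  rw [logChar, Complex.sub_re, Complex.log_re, norm_one_add_I_mul, Real.log_sqrt (by positivity)]
  simp

/-- The derivative of the left-hand function is x · ix/(1 + ix), of modulus at most x²; the mean
value inequality on [-|u|, |u|] yields the cube. -/
theorem norm_logChar_add_sq_half_le (u : ℝ) : ‖logChar u + (u : ℂ) ^ 2 / 2‖ ≤ |u| ^ 3 := by
  have hd : ∀ x : ℝ, HasDerivAt (fun x : ℝ => logChar x + (x : ℂ) ^ 2 / 2)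
      (x * (Complex.I * x) / (1 + Complex.I * x)) x := by
    intro x
    have h0 : HasDerivAt (fun x : ℝ => (x : ℂ)) 1 x := Complex.ofRealCLM.hasDerivAt
    have h1 : HasDerivAt (fun x : ℝ => Complex.I * (x : ℂ)) (Complex.I * 1) x := h0.const_mul _
    have h2 := (h1.const_add 1).clog_real (one_add_I_mul_mem_slitPlane x)
    have h3 := (h1.sub h2).add ((h0.pow 2).div_const 2)
    refine h3.congr_deriv ?_
    have := one_add_I_mul_ne_zero x
    field_simp
    ring_nf
    simp [Complex.I_sq]
  have hb : ∀ x ∈ Set.Icc (-|u|) |u|,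
      ‖(x * (Complex.I * x) / (1 + Complex.I * x) : ℂ)‖ ≤ |u| ^ 2 := by
    intro x hx
    have hxu : |x| ≤ |u| := abs_le.2 hx
    rw [norm_div, norm_one_add_I_mul]
    have h1 : (1 : ℝ) ≤ Real.sqrt (1 + x ^ 2) := by
      rw [Real.one_le_sqrt]; nlinarith [sq_nonneg x]
    have h2 : ‖(x * (Complex.I * x) : ℂ)‖ = |x| ^ 2 := by
      simp [sq]
    rw [h2]
    calc |x| ^ 2 / Real.sqrt (1 + x ^ 2) ≤ |x| ^ 2 := div_le_self (by positivity) h1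
      _ ≤ |u| ^ 2 := by gcongr
  have key := Convex.norm_image_sub_le_of_norm_hasDerivWithin_le
    (f := fun x : ℝ => logChar x + (x : ℂ) ^ 2 / 2)
    (fun x _ => (hd x).hasDerivWithinAt) hb (convex_Icc _ _)
    (x := 0) (y := u) (by simp) ⟨neg_abs_le u, le_abs_self u⟩
  simp [logChar] at key
  rw [logChar]
  calc _ ≤ _ := key
    _ = |u| ^ 3 := by rw [← sq_abs u]; ring

theorem norm_exp_sub_exp_le (a b : ℂ) {M : ℝ} (ha : a.re ≤ M) (hb : b.re ≤ M) :
    ‖Complex.exp a - Complex.exp b‖ ≤ Real.exp M * ‖a - b‖ := by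
  refine Convex.norm_image_sub_le_of_norm_hasDerivWithin_le (f := Complex.exp)
    (f' := Complex.exp) (s := {c : ℂ | c.re ≤ M})
    (fun x _ => (Complex.hasDerivAt_exp x).hasDerivWithinAt) (fun x hx => ?_)
    (convex_halfSpace_re_le M) hb ha
  rw [Complex.norm_exp]
  exact Real.exp_le_exp.2 hx

/-- Concavity of the logarithm, as Bernoulli's inequality (1 + M)^{s/M} ≤ 1 + s. -/
theorem sq_div_mul_log_le {s M : ℝ} (hs : 0 ≤ s) (hsM : s ≤ M) (hM : 0 < M) :
    s / M * Real.log (1 + M) ≤ Real.log (1 + s) := by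
  rw [← Real.log_rpow (by linarith)]
  apply Real.log_le_log (by positivity)
  have := rpow_one_add_le_one_add_mul_self (s := M) (by linarith) (p := s / M) (by positivity)
    (by rwa [div_le_one hM])
  rwa [div_mul_cancel₀ _ hM.ne'] at this

/-- Log-convexity of Γ: m - p + 1 divides the segment from m - p to m with weight 1/p at m, and Γ(m
- p + 1) = (m - p) Γ(m - p). Raising to the power p gives the claim. -/
theorem Gamma_sub_mul_rpow_le {m p : ℝ} (hp : 1 ≤ p) (hpm : p < m) :
    (m - p) ^ p * Real.Gamma (m - p) ≤ Real.Gamma m := by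
  have hx : 0 < m - p := by linarith
  have hG : 0 < Real.Gamma (m - p) := Real.Gamma_pos_of_pos hx
  have hG' : 0 < Real.Gamma m := Real.Gamma_pos_of_pos (by linarith)
  rcases hp.eq_or_lt with rfl | hp1
  · have := Real.Gamma_add_one hx.ne'
    rw [sub_add_cancel] at this
    rw [this, Real.rpow_one]
  · have hp0 : 0 < p := by linarith
    have h := Real.Gamma_mul_add_mul_le_rpow_Gamma_mul_rpow_Gamma (s := m - p) (t := m)
      (a := 1 - 1 / p) (b := 1 / p) hx (by linarith)
      (by rw [sub_pos, div_lt_one hp0]; exact hp1) (by positivity) (by ring)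
    have e : (1 - 1 / p) * (m - p) + 1 / p * m = (m - p) + 1 := by field_simp; ring
    rw [e, Real.Gamma_add_one hx.ne'] at h
    have h2 : ((m - p) * Real.Gamma (m - p)) ^ p ≤
        (Real.Gamma (m - p) ^ (1 - 1 / p) * Real.Gamma m ^ (1 / p)) ^ p :=
      Real.rpow_le_rpow (by positivity) h hp0.le
    rw [Real.mul_rpow hx.le hG.le, Real.mul_rpow (by positivity) (by positivity),
      ← Real.rpow_mul hG.le, ← Real.rpow_mul hG'.le, one_div_mul_cancel hp0.ne', Real.rpow_one,
      sub_mul, one_mul, one_div_mul_cancel hp0.ne', Real.rpow_sub hG, Real.rpow_one] at h2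
    have hGp : 0 < Real.Gamma (m - p) ^ p := Real.rpow_pos_of_pos hG _
    rw [div_mul_eq_mul_div, le_div_iff₀ hG] at h2
    have h3 : Real.Gamma (m - p) ^ p * ((m - p) ^ p * Real.Gamma (m - p)) ≤
        Real.Gamma (m - p) ^ p * Real.Gamma m := by
      calc _ = (m - p) ^ p * Real.Gamma (m - p) ^ p * Real.Gamma (m - p) := by ring
        _ ≤ _ := h2
    exact le_of_mul_le_mul_left h3 hGp

end Scalar

/-! ### Pointwise bounds for the characteristic function of a sum of exponentials. -/

section QuadraticSum

variable {E ι : Type*} [Fintype ι] [AddCommGroup E] [Module ℝ E]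

/-- Half the sum of the squares of a family of linear functionals. -/
def halfSq (u : ι → E →ₗ[ℝ] ℝ) (t : E) : ℝ := 1 / 2 * ∑ j, u j t ^ 2

theorem halfSq_nonneg (u : ι → E →ₗ[ℝ] ℝ) (t : E) : 0 ≤ halfSq u t := by
  unfold halfSq; positivity

theorem halfSq_smul (u : ι → E →ₗ[ℝ] ℝ) (c : ℝ) (t : E) :
    halfSq u (c • t) = c ^ 2 * halfSq u t := by
  simp only [halfSq, map_smul, smul_eq_mul, mul_pow, ← Finset.mul_sum]
  ring

/-- The product of the characteristic functions of centered exponential variables. -/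
def charProd (u : ι → E →ₗ[ℝ] ℝ) (t : E) : ℂ :=
  ∏ j, Complex.exp (Complex.I * u j t) / (1 + Complex.I * u j t)

theorem charProd_eq_exp (u : ι → E →ₗ[ℝ] ℝ) (t : E) :
    charProd u t = Complex.exp (∑ j, logChar (u j t)) := by
  rw [Complex.exp_sum]
  exact Finset.prod_congr rfl fun j _ => (exp_logChar _).symm

/-- Each u_j² lies in [0, M] with M = κQ, where log(1 + s) is above its chord. Summing the chords
with ∑ u_j² = 2Q leaves (1/κ) log(1 + κQ). -/
theorem sum_logChar_re_le (u : ι → E →ₗ[ℝ] ℝ) {κ : ℝ} (hκ : 0 < κ)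
    (hu : ∀ j t, u j t ^ 2 ≤ κ * halfSq u t) (t : E) :
    (∑ j, logChar (u j t)).re ≤ -(1 / κ) * Real.log (1 + κ * halfSq u t) := by
  rw [Complex.re_sum]
  simp only [logChar_re, Finset.sum_neg_distrib]
  rcases (halfSq_nonneg u t).eq_or_lt with h0 | h0
  · rw [← h0]
    simp only [mul_zero, add_zero, Real.log_one, Left.neg_nonpos_iff]
    exact Finset.sum_nonneg fun j _ =>
      div_nonneg (Real.log_nonneg (by nlinarith [sq_nonneg (u j t)])) zero_le_two
  · rw [neg_mul, neg_le_neg_iff]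
    have hM : 0 < κ * halfSq u t := by positivity
    calc 1 / κ * Real.log (1 + κ * halfSq u t)
        = ∑ j, u j t ^ 2 / (κ * halfSq u t) * Real.log (1 + κ * halfSq u t) / 2 := by
          rw [← Finset.sum_div, ← Finset.sum_mul, ← Finset.sum_div]
          have : ∑ j, u j t ^ 2 = 2 * halfSq u t := by unfold halfSq; ring
          rw [this]
          field_simp
      _ ≤ _ := by
          gcongr with j
          exact sq_div_mul_log_le (sq_nonneg _) (hu j t) hM

theorem norm_charProd_le (u : ι → E →ₗ[ℝ] ℝ) {κ : ℝ} (hκ : 0 < κ)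
    (hu : ∀ j t, u j t ^ 2 ≤ κ * halfSq u t) (t : E) :
    ‖charProd u t‖ ≤ (1 + κ * halfSq u t) ^ (-(1 / κ)) := by
  have h1 : 0 < 1 + κ * halfSq u t := by have := halfSq_nonneg u t; positivity
  rw [charProd_eq_exp, Complex.norm_exp, Real.rpow_def_of_pos h1, mul_comm]
  exact Real.exp_le_exp.2 (sum_logChar_re_le u hκ hu t)

/-- Both functions are exponentials whose exponents have real part at most -(1/κ) log(1 + κQ), and
the exponents differ by the cubic remainders of `logChar`. The mean value inequality for exp on a
half-plane combines the two facts. -/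
theorem norm_charProd_sub_exp_le (u : ι → E →ₗ[ℝ] ℝ) {κ : ℝ} (hκ : 0 < κ)
    (hu : ∀ j t, u j t ^ 2 ≤ κ * halfSq u t) (t : E) :
    ‖charProd u t - (Real.exp (-halfSq u t) : ℝ)‖ ≤
      ∑ j, |u j t| ^ 3 * (1 + κ * halfSq u t) ^ (-(1 / κ)) := by
  have h1 : 0 < 1 + κ * halfSq u t := by have := halfSq_nonneg u t; positivity
  rw [charProd_eq_exp, Complex.ofReal_exp, Real.rpow_def_of_pos h1, ← Finset.sum_mul, mul_comm,
    mul_comm (Real.log _)]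
  -- Since log(1 + x) ≤ x, the Gaussian exponent obeys the same bound.
  have hq : ((-halfSq u t : ℝ) : ℂ).re ≤ -(1 / κ) * Real.log (1 + κ * halfSq u t) := by
    rw [Complex.ofReal_re, neg_mul, neg_le_neg_iff, one_div, inv_mul_le_iff₀ hκ]
    have := Real.log_le_sub_one_of_pos h1
    linarith
  refine (norm_exp_sub_exp_le _ _ (sum_logChar_re_le u hκ hu t) hq).trans ?_
  gcongr
  have : ∑ j, logChar (u j t) - ((-halfSq u t : ℝ) : ℂ) =
      ∑ j, (logChar (u j t) + (u j t : ℂ) ^ 2 / 2) := by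
    rw [Finset.sum_add_distrib, ← Finset.sum_div, halfSq]
    push_cast
    ring
  rw [this]
  exact (norm_sum_le _ _).trans (Finset.sum_le_sum fun j _ => norm_logChar_add_sq_half_le _)

end QuadraticSum

/-! ### Gaussian moments and the integrated error. -/

section Integrals

variable {E ι : Type*} [Fintype ι] [NormedAddCommGroup E] [NormedSpace ℝ E]
  [FiniteDimensional ℝ E]

theorem continuous_halfSq (u : ι → E →ₗ[ℝ] ℝ) : Continuous (halfSq u) := by
  have : ∀ j, Continuous (u j) := fun j => (u j).continuous_of_finiteDimensional
  unfold halfSq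
  fun_prop

theorem continuous_charProd (u : ι → E →ₗ[ℝ] ℝ) : Continuous (charProd u) := by
  have : ∀ j, Continuous (u j) := fun j => (u j).continuous_of_finiteDimensional
  unfold charProd
  refine continuous_finsetProd _ fun j _ => Continuous.div (by fun_prop) (by fun_prop) fun t => ?_
  exact one_add_I_mul_ne_zero _

variable [MeasurableSpace E] [BorelSpace E] (μ : Measure E) [μ.IsAddHaarMeasure]

theorem lintegral_comp_smul_of_pos (f : E → ENNReal) (hf : Measurable f) {c : ℝ} (hc : 0 < c) :
    ∫⁻ t, f (c • t) ∂μ = ENNReal.ofReal (c ^ (-(Module.finrank ℝ E : ℝ))) * ∫⁻ t, f t ∂μ := by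
  rw [← lintegral_map hf (by fun_prop), Measure.map_addHaar_smul μ hc.ne', lintegral_smul_measure,
    smul_eq_mul, abs_of_pos (by positivity), Real.rpow_neg hc.le, Real.rpow_natCast]

/-- Scaling of a Gaussian moment of a homogeneous function. -/
theorem lintegral_mul_exp_neg_mul_halfSq (u : ι → E →ₗ[ℝ] ℝ) (h : E → ℝ) (hm : Measurable h)
    {r : ℕ} (hh : ∀ (c : ℝ) t, 0 < c → h (c • t) = c ^ r * h t)
    {s : ℝ} (hs : 0 < s) :
    ∫⁻ t, ENNReal.ofReal (h t * Real.exp (-(s * halfSq u t))) ∂μ =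
      ENNReal.ofReal (s ^ (-(((Module.finrank ℝ E : ℝ) + r) / 2))) *
        ∫⁻ t, ENNReal.ofReal (h t * Real.exp (-halfSq u t)) ∂μ := by
  have hsq : 0 < Real.sqrt s := Real.sqrt_pos.2 hs
  have hQ := (continuous_halfSq u).measurable
  have h1 := lintegral_comp_smul_of_pos μ
    (fun t => ENNReal.ofReal (h t * Real.exp (-halfSq u t))) (by fun_prop) hsq
  have h2 : ∀ t, ENNReal.ofReal (h t * Real.exp (-(s * halfSq u t))) =
      ENNReal.ofReal ((Real.sqrt s) ^ (-(r : ℝ))) *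
        ENNReal.ofReal (h (Real.sqrt s • t) * Real.exp (-halfSq u (Real.sqrt s • t))) := by
    intro t
    rw [← ENNReal.ofReal_mul (by positivity), hh _ _ hsq, halfSq_smul, Real.sq_sqrt hs.le,
      Real.rpow_neg hsq.le, Real.rpow_natCast]
    congr 1
    field_simp
  simp_rw [h2]
  rw [lintegral_const_mul _ (by fun_prop), h1, ← mul_assoc, ← ENNReal.ofReal_mul (by positivity),
    ← Real.rpow_add hsq, Real.sqrt_eq_rpow, ← Real.rpow_mul hs.le]
  congr 3
  ring

/-- The function `(1 + κ q)^{-1/κ}` is a mixture of the Gaussians `exp (-s κ q)`, hence its moments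
are controlled by the Gaussian moments. -/
theorem lintegral_mul_one_add_rpow_le (u : ι → E →ₗ[ℝ] ℝ) (h : E → ℝ) (hm : Measurable h)
    (h0 : ∀ t, 0 ≤ h t) {r : ℕ} (hh : ∀ (c : ℝ) t, 0 < c → h (c • t) = c ^ r * h t)
    {κ p : ℝ} (hκ : 0 < κ) (hp : p = ((Module.finrank ℝ E : ℝ) + r) / 2) (hp1 : 1 ≤ p)
    (hpκ : p * κ < 1) :
    ∫⁻ t, ENNReal.ofReal (h t * (1 + κ * halfSq u t) ^ (-(1 / κ))) ∂μ ≤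
      ENNReal.ofReal ((1 - p * κ) ^ (-p)) *
        ∫⁻ t, ENNReal.ofReal (h t * Real.exp (-halfSq u t)) ∂μ := by
  set m : ℝ := 1 / κ with hmdef
  have hm0 : 0 < m := by positivity
  have hpm : p < m := by rw [hmdef, lt_div_iff₀ hκ]; exact hpκ
  have hG : 0 < Real.Gamma m := Real.Gamma_pos_of_pos hm0
  have hQ := (continuous_halfSq u).measurable
  have hint : ∀ {a r : ℝ}, 0 < a → 0 < r →
      IntegrableOn (fun s : ℝ => s ^ (a - 1) * Real.exp (-(r * s))) (Set.Ioi 0) := by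
    intro a r ha hr
    have := integrableOn_rpow_mul_exp_neg_mul_rpow (p := 1) (s := a - 1) (b := r) (by linarith)
      one_pos hr
    simpa using this
  have hlint : ∀ {a r : ℝ}, 0 < a → 0 < r →
      ∫⁻ s in Set.Ioi (0 : ℝ), ENNReal.ofReal (s ^ (a - 1) * Real.exp (-(r * s))) =
        ENNReal.ofReal ((1 / r) ^ a * Real.Gamma a) := by
    intro a r ha hr
    rw [← Real.integral_rpow_mul_exp_neg_mul_Ioi ha hr,
      ofReal_integral_eq_lintegral_ofReal (hint ha hr)]
    filter_upwards [ae_restrict_mem measurableSet_Ioi] with s hs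
    have : 0 < s := hs
    positivity
  -- The Gamma integral: Γ(m)(1 + κQ)^{-m} = ∫ s^{m-1} e^{-s} e^{-κsQ} ds.
  have hmix : ∀ t, ENNReal.ofReal (h t * (1 + κ * halfSq u t) ^ (-m)) =
      ENNReal.ofReal (Real.Gamma m)⁻¹ * ∫⁻ s in Set.Ioi (0 : ℝ), ENNReal.ofReal
        (s ^ (m - 1) * Real.exp (-s) * (h t * Real.exp (-((κ * s) * halfSq u t)))) := by
    intro t
    have h1 : 0 < 1 + κ * halfSq u t := by have := halfSq_nonneg u t; positivity
    have e : ∀ s : ℝ, ENNReal.ofReal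
        (s ^ (m - 1) * Real.exp (-s) * (h t * Real.exp (-((κ * s) * halfSq u t)))) =
        ENNReal.ofReal (h t) * ENNReal.ofReal
          (s ^ (m - 1) * Real.exp (-((1 + κ * halfSq u t) * s))) := by
      intro s
      rw [← ENNReal.ofReal_mul (h0 t)]
      congr 1
      have : Real.exp (-((1 + κ * halfSq u t) * s)) =
          Real.exp (-s) * Real.exp (-((κ * s) * halfSq u t)) := by
        rw [← Real.exp_add]; congr 1; ring
      rw [this]; ring
    simp_rw [e]
    rw [lintegral_const_mul _ (by fun_prop), hlint hm0 h1, ← ENNReal.ofReal_mul (h0 t),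
      ← ENNReal.ofReal_mul (by positivity), one_div, Real.inv_rpow h1.le, Real.rpow_neg h1.le]
    congr 1
    field_simp
  simp_rw [hmix]
  rw [lintegral_const_mul _ (Measurable.lintegral_prod_right' (f := fun z : E × ℝ =>
    ENNReal.ofReal (z.2 ^ (m - 1) * Real.exp (-z.2) *
      (h z.1 * Real.exp (-((κ * z.2) * halfSq u z.1))))) (by fun_prop)),
    lintegral_lintegral_swap (by unfold Function.uncurry; fun_prop)]
  set I := ∫⁻ t, ENNReal.ofReal (h t * Real.exp (-halfSq u t)) ∂μ with hI
  -- After Tonelli the inner Gaussian moment scales as (κs)^{-p}, which lowers the Gamma parameter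
  -- from m to m - p.
  have hinner : ∫⁻ s in Set.Ioi (0 : ℝ), ∫⁻ t, ENNReal.ofReal
        (s ^ (m - 1) * Real.exp (-s) * (h t * Real.exp (-((κ * s) * halfSq u t)))) ∂μ =
      ∫⁻ s in Set.Ioi (0 : ℝ), ENNReal.ofReal (κ ^ (-p)) * I *
        ENNReal.ofReal (s ^ (m - p - 1) * Real.exp (-(1 * s))) := by
    refine setLIntegral_congr_fun measurableSet_Ioi fun s hs => ?_
    have hs : 0 < s := hs
    have hc : 0 ≤ s ^ (m - 1) * Real.exp (-s) := by positivity
    simp only [ENNReal.ofReal_mul hc]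
    rw [lintegral_const_mul _ (by fun_prop),
      lintegral_mul_exp_neg_mul_halfSq μ u h hm hh (mul_pos hκ hs), ← hp, ← hI,
      Real.mul_rpow hκ.le hs.le, ENNReal.ofReal_mul (Real.rpow_nonneg hκ.le (-p))]
    have : ENNReal.ofReal (s ^ (m - p - 1) * Real.exp (-(1 * s))) =
        ENNReal.ofReal (s ^ (m - 1) * Real.exp (-s)) * ENNReal.ofReal (s ^ (-p)) := by
      rw [← ENNReal.ofReal_mul hc, show m - p - 1 = (m - 1) + -p by ring, Real.rpow_add hs,
        one_mul]
      congr 1; ring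
    rw [this, ENNReal.ofReal_mul (by positivity)]
    ring
  rw [hinner, lintegral_const_mul _ (by fun_prop), hlint (by linarith) one_pos]
  have hbound : (Real.Gamma m)⁻¹ * (κ ^ (-p) * ((1 / 1) ^ (m - p) * Real.Gamma (m - p))) ≤
      (1 - p * κ) ^ (-p) := by
    have h1 : 0 < 1 - p * κ := by linarith
    have h2 : 1 - p * κ = κ * (m - p) := by rw [hmdef]; field_simp
    have hmp : 0 < m - p := by linarith
    rw [h2, Real.mul_rpow hκ.le hmp.le, div_one, Real.one_rpow, one_mul, inv_mul_le_iff₀ hG]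
    have h3 := Gamma_sub_mul_rpow_le hp1 hpm
    have h4 : Real.Gamma (m - p) ≤ Real.Gamma m * (m - p) ^ (-p) := by
      rw [Real.rpow_neg hmp.le, ← div_eq_mul_inv, le_div_iff₀ (by positivity)]
      linarith
    calc κ ^ (-p) * Real.Gamma (m - p) ≤ κ ^ (-p) * (Real.Gamma m * (m - p) ^ (-p)) := by gcongr
      _ = _ := by ring
  calc _ = ENNReal.ofReal ((Real.Gamma m)⁻¹ *
        (κ ^ (-p) * ((1 / 1) ^ (m - p) * Real.Gamma (m - p)))) * I := by
        have : 0 < Real.Gamma (m - p) := Real.Gamma_pos_of_pos (by linarith)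
        rw [ENNReal.ofReal_mul (inv_nonneg.2 hG.le),
          ENNReal.ofReal_mul (Real.rpow_nonneg hκ.le (-p))]
        ring
    _ ≤ _ := by gcongr

/-- Exponential moments of a linear functional under a Gaussian density. -/
theorem lintegral_exp_sub_halfSq_le (u : ι → E →ₗ[ℝ] ℝ) (hpos : ∀ t, t ≠ 0 → 0 < halfSq u t)
    (l : E →ₗ[ℝ] ℝ) {c : ℝ} (hc : 0 ≤ c) (hl : ∀ t, l t ^ 2 ≤ c * halfSq u t) :
    ∫⁻ t, ENNReal.ofReal (Real.exp (l t - halfSq u t)) ∂μ ≤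
      ENNReal.ofReal (Real.exp (c / 4)) * ∫⁻ t, ENNReal.ofReal (Real.exp (-halfSq u t)) ∂μ := by
  -- The polar form of 2Q is nondegenerate, so l is represented by some s; completing the square
  -- then turns l - Q into Q(s) - Q(t - s).
  let b : E →ₗ[ℝ] Module.Dual ℝ E := ∑ j, (u j).smulRight (u j)
  have hb : ∀ s t, b s t = ∑ j, u j s * u j t := by
    intro s t
    simp [b, LinearMap.sum_apply]
  have hinj : Function.Injective b := by
    rw [injective_iff_map_eq_zero]
    intro s hs
    by_contra hne
    have h1 := hpos s hne
    have h2 := hb s s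
    rw [hs, LinearMap.zero_apply] at h2
    have : halfSq u s = 0 := by
      unfold halfSq
      simp only [sq]
      rw [← h2, mul_zero]
    linarith
  have hsurj : Function.Surjective b :=
    (LinearMap.injective_iff_surjective_of_finrank_eq_finrank
      Subspace.dual_finrank_eq.symm).1 hinj
  obtain ⟨s, hs⟩ := hsurj l
  have hls : ∀ t, l t = ∑ j, u j s * u j t := fun t => by rw [← hs, hb]
  have hQs : l s = 2 * halfSq u s := by
    rw [hls, halfSq]
    simp only [sq]
    ring
  have hshift : ∀ t, l t - halfSq u t = halfSq u s + -halfSq u (t - s) := by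
    intro t
    have : halfSq u (t - s) = halfSq u t - l t + halfSq u s := by
      rw [hls]
      simp only [halfSq, map_sub, Finset.mul_sum]
      rw [← Finset.sum_sub_distrib, ← Finset.sum_add_distrib]
      refine Finset.sum_congr rfl fun j _ => ?_
      ring
    rw [this]; ring
  -- From l(s) = 2Q(s) the hypothesis at s reads 4Q(s)² ≤ cQ(s).
  have hQ4 : halfSq u s ≤ c / 4 := by
    have h := hl s
    rw [hQs] at h
    rcases (halfSq_nonneg u s).eq_or_lt with h0 | h0
    · by_cases hs0 : s = 0
      · rw [← h0]; positivity
      · exact absurd h0 (hpos s hs0).ne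
    · nlinarith
  simp_rw [hshift, Real.exp_add, ENNReal.ofReal_mul (Real.exp_pos _).le]
  rw [lintegral_const_mul' _ _ ENNReal.ofReal_ne_top,
    lintegral_sub_right_eq_self (fun t => ENNReal.ofReal (Real.exp (-halfSq u t))) s]
  gcongr

/-- After scaling l by √κ, use x³ ≤ 6e^x for x ≥ 0 and e^{|x|} ≤ e^x + e^{-x}; each exponential
moment costs e^{1/4}, whence 12 = 6 · 2. -/
theorem lintegral_abs_cube_mul_exp_neg_halfSq_le (u : ι → E →ₗ[ℝ] ℝ)
    (hpos : ∀ t, t ≠ 0 → 0 < halfSq u t) (l : E →ₗ[ℝ] ℝ) {κ : ℝ} (hκ : 0 < κ)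
    (hl : ∀ t, l t ^ 2 ≤ κ * halfSq u t) :
    ∫⁻ t, ENNReal.ofReal (|l t| ^ 3 * Real.exp (-halfSq u t)) ∂μ ≤
      ENNReal.ofReal (12 * Real.exp (1 / 4) * Real.sqrt κ ^ 3) *
        ∫⁻ t, ENNReal.ofReal (Real.exp (-halfSq u t)) ∂μ := by
  set σ := Real.sqrt κ with hσ
  have hσ0 : 0 < σ := Real.sqrt_pos.2 hκ
  have hσκ : σ ^ 2 = κ := Real.sq_sqrt hκ.le
  have hQ := (continuous_halfSq u).measurable
  have hlm : Measurable l := l.continuous_of_finiteDimensional.measurable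
  have hl1 : ∀ t, (σ⁻¹ • l) t ^ 2 ≤ 1 * halfSq u t := by
    intro t
    rw [LinearMap.smul_apply, smul_eq_mul, mul_pow, inv_pow, hσκ, inv_mul_le_iff₀ hκ, one_mul]
    exact hl t
  have hl2 : ∀ t, (-(σ⁻¹ • l)) t ^ 2 ≤ 1 * halfSq u t := by
    intro t
    rw [LinearMap.neg_apply, neg_sq]
    exact hl1 t
  have hpt : ∀ t, ENNReal.ofReal (|l t| ^ 3 * Real.exp (-halfSq u t)) ≤
      ENNReal.ofReal (6 * σ ^ 3) * (ENNReal.ofReal (Real.exp ((σ⁻¹ • l) t - halfSq u t)) +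
        ENNReal.ofReal (Real.exp ((-(σ⁻¹ • l)) t - halfSq u t))) := by
    intro t
    rw [← ENNReal.ofReal_add (by positivity) (by positivity),
      ← ENNReal.ofReal_mul (by positivity)]
    apply ENNReal.ofReal_le_ofReal
    have h1 := Real.pow_div_factorial_le_exp (|l t| / σ) (by positivity) 3
    have h2 : Real.exp (|l t| / σ) ≤ Real.exp (l t / σ) + Real.exp (-(l t / σ)) := by
      rcases abs_cases (l t) with ⟨h, _⟩ | ⟨h, _⟩ <;> rw [h]
      · linarith [Real.exp_pos (-(l t / σ))]
      · rw [neg_div]; linarith [Real.exp_pos (l t / σ)]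
    have h3 : |l t| ^ 3 ≤ 6 * σ ^ 3 * Real.exp (|l t| / σ) := by
      rw [div_pow, div_div, div_le_iff₀ (by positivity)] at h1
      simp only [Nat.factorial] at h1
      push_cast at h1
      linarith
    simp only [LinearMap.neg_apply, LinearMap.smul_apply, smul_eq_mul, sub_eq_add_neg,
      Real.exp_add]
    rw [← add_mul, ← mul_assoc, show σ⁻¹ * l t = l t / σ by rw [div_eq_inv_mul]]
    gcongr
    refine h3.trans ?_
    gcongr
  calc _ ≤ ∫⁻ t, ENNReal.ofReal (6 * σ ^ 3) *
        (ENNReal.ofReal (Real.exp ((σ⁻¹ • l) t - halfSq u t)) +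
          ENNReal.ofReal (Real.exp ((-(σ⁻¹ • l)) t - halfSq u t))) ∂μ := lintegral_mono hpt
    _ = ENNReal.ofReal (6 * σ ^ 3) *
        (∫⁻ t, ENNReal.ofReal (Real.exp ((σ⁻¹ • l) t - halfSq u t)) ∂μ +
          ∫⁻ t, ENNReal.ofReal (Real.exp ((-(σ⁻¹ • l)) t - halfSq u t)) ∂μ) := by
        rw [lintegral_const_mul' _ _ ENNReal.ofReal_ne_top, lintegral_add_left]
        simp only [LinearMap.smul_apply]
        fun_prop
    _ ≤ ENNReal.ofReal (6 * σ ^ 3) *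
        (ENNReal.ofReal (Real.exp (1 / 4)) * ∫⁻ t, ENNReal.ofReal (Real.exp (-halfSq u t)) ∂μ +
          ENNReal.ofReal (Real.exp (1 / 4)) *
            ∫⁻ t, ENNReal.ofReal (Real.exp (-halfSq u t)) ∂μ) := by
        gcongr
        · exact lintegral_exp_sub_halfSq_le μ u hpos _ zero_le_one hl1
        · exact lintegral_exp_sub_halfSq_le μ u hpos _ zero_le_one hl2
    _ = _ := by
        rw [show 12 * Real.exp (1 / 4) * σ ^ 3 = (6 * σ ^ 3) * (2 * Real.exp (1 / 4)) by ring,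
          ENNReal.ofReal_mul (p := 6 * σ ^ 3) (by positivity),
          ENNReal.ofReal_mul (p := 2) (by positivity), ENNReal.ofReal_ofNat]
        ring

/-- The mixture bound with the constant function h = 1, of degree r = 0; dimension at least 2
supplies d/2 ≥ 1. -/
theorem integrable_charProd (u : ι → E →ₗ[ℝ] ℝ) {κ : ℝ} (hκ : 0 < κ)
    (hu : ∀ j t, u j t ^ 2 ≤ κ * halfSq u t)
    (hint : Integrable (fun t => Real.exp (-halfSq u t)) μ) (hd : 2 ≤ Module.finrank ℝ E)
    (hκd : (Module.finrank ℝ E : ℝ) / 2 * κ < 1) : Integrable (charProd u) μ := by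
  have hd' : (2 : ℝ) ≤ Module.finrank ℝ E := by exact_mod_cast hd
  refine ⟨(continuous_charProd u).aestronglyMeasurable, ?_⟩
  have h := lintegral_mul_one_add_rpow_le μ u (fun _ => 1) measurable_const (fun _ => zero_le_one)
    (r := 0) (by simp) hκ rfl (by push_cast; linarith) (by push_cast; simpa using hκd)
  simp only [one_mul] at h
  refine lt_of_le_of_lt (lintegral_mono fun t => ?_) (h.trans_lt ?_)
  · rw [← ofReal_norm]
    exact ENNReal.ofReal_le_ofReal (norm_charProd_le u hκ hu t)
  · exact ENNReal.mul_lt_top ENNReal.ofReal_lt_top hint.lintegral_lt_top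

/-- The integral of the characteristic function is close to the Gaussian integral. -/
theorem norm_integral_charProd_sub_le (u : ι → E →ₗ[ℝ] ℝ) (hpos : ∀ t, t ≠ 0 → 0 < halfSq u t)
    {κ p : ℝ} (hκ : 0 < κ) (hu : ∀ j t, u j t ^ 2 ≤ κ * halfSq u t)
    (hint : Integrable (fun t => Real.exp (-halfSq u t)) μ) (hd : 2 ≤ Module.finrank ℝ E)
    (hp : p = ((Module.finrank ℝ E : ℝ) + 3) / 2) (hpκ : p * κ < 1) :
    ‖∫ t, charProd u t ∂μ - (∫ t, Real.exp (-halfSq u t) ∂μ : ℝ)‖ ≤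
      Fintype.card ι * ((1 - p * κ) ^ (-p) * (12 * Real.exp (1 / 4) * Real.sqrt κ ^ 3)) *
        ∫ t, Real.exp (-halfSq u t) ∂μ := by
  have hd' : (2 : ℝ) ≤ Module.finrank ℝ E := by exact_mod_cast hd
  have hp1 : 1 ≤ p := by rw [hp]; linarith
  have hψ : Integrable (charProd u) μ :=
    integrable_charProd μ u hκ hu hint hd (by rw [hp] at hpκ; nlinarith)
  have hum : ∀ j, Measurable (u j) := fun j =>
    (u j).continuous_of_finiteDimensional.measurable
  have hQ := (continuous_halfSq u).measurable
  have hC : 0 ≤ Fintype.card ι *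
      ((1 - p * κ) ^ (-p) * (12 * Real.exp (1 / 4) * Real.sqrt κ ^ 3)) := by
    have : 0 < 1 - p * κ := by linarith
    positivity
  have hint' : Integrable (fun t => ((Real.exp (-halfSq u t) : ℝ) : ℂ)) μ := hint.ofReal
  rw [← integral_complex_ofReal, ← integral_sub hψ hint']
  refine (norm_integral_le_lintegral_norm _).trans (ENNReal.toReal_le_of_le_ofReal
    (mul_nonneg hC (integral_nonneg fun t => (Real.exp_pos _).le)) ?_)
  rw [ENNReal.ofReal_mul hC, ofReal_integral_eq_lintegral_ofReal hint
    (Eventually.of_forall fun t => (Real.exp_pos _).le)]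
  set I := ∫⁻ t, ENNReal.ofReal (Real.exp (-halfSq u t)) ∂μ with hI
  calc ∫⁻ t, ENNReal.ofReal ‖charProd u t - (Real.exp (-halfSq u t) : ℝ)‖ ∂μ
      ≤ ∫⁻ t, ∑ j, ENNReal.ofReal
          (|u j t| ^ 3 * (1 + κ * halfSq u t) ^ (-(1 / κ))) ∂μ := by
        refine lintegral_mono fun t => ?_
        have : 0 ≤ 1 + κ * halfSq u t := by have := halfSq_nonneg u t; positivity
        rw [← ENNReal.ofReal_sum_of_nonneg fun j _ => by positivity]
        exact ENNReal.ofReal_le_ofReal (norm_charProd_sub_exp_le u hκ hu t)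
    _ = ∑ j, ∫⁻ t, ENNReal.ofReal
          (|u j t| ^ 3 * (1 + κ * halfSq u t) ^ (-(1 / κ))) ∂μ := by
        refine lintegral_finsetSum _ fun j _ => ?_
        have := hum j
        fun_prop
    _ ≤ ∑ _j : ι, ENNReal.ofReal ((1 - p * κ) ^ (-p)) *
          (ENNReal.ofReal (12 * Real.exp (1 / 4) * Real.sqrt κ ^ 3) * I) := by
        refine Finset.sum_le_sum fun j _ => ?_
        have := hum j
        refine (lintegral_mul_one_add_rpow_le μ u (fun t => |u j t| ^ 3) (by fun_prop)
          (fun t => by positivity) (r := 3) (fun c t hc => ?_) hκ (by rw [hp]; norm_num) hp1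
          hpκ).trans ?_
        · rw [map_smul, smul_eq_mul, abs_mul, abs_of_pos hc, mul_pow]
        · gcongr
          exact lintegral_abs_cube_mul_exp_neg_halfSq_le μ u hpos (u j) hκ (hu j)
    _ = _ := by
        have : 0 < 1 - p * κ := by linarith
        rw [Finset.sum_const, Finset.card_univ, nsmul_eq_mul,
          ENNReal.ofReal_mul (p := (Fintype.card ι : ℝ)) (by positivity),
          ENNReal.ofReal_mul (p := (1 - p * κ) ^ (-p)) (by positivity), ENNReal.ofReal_natCast]
        ring

end Integrals

/-! ### Linear changes of variables and fibre coordinates. -/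

section ChangeOfVariables

variable {U V : Type*} [NormedAddCommGroup U] [InnerProductSpace ℝ U] [FiniteDimensional ℝ U]
  [NormedAddCommGroup V] [InnerProductSpace ℝ V]

theorem normDet_pos_of_injective {f : U →ₗ[ℝ] V} (hf : Function.Injective f) : 0 < f.normDet := by
  refine lt_of_le_of_ne f.normDet_nonneg fun h => ?_
  exact LinearMap.normDet_eq_zero_iff_ker_ne_bot.1 h.symm (LinearMap.ker_eq_bot.2 hf)

theorem normDet_ofInjective {f : U →ₗ[ℝ] V} (hf : Function.Injective f) :
    ((LinearEquiv.ofInjective f hf : U ≃ₗ[ℝ] LinearMap.range f) :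
      U →ₗ[ℝ] LinearMap.range f).normDet = f.normDet :=
  LinearMap.normDet_codRestrict (f := f) fun c => LinearMap.mem_range_self f c

variable [MeasurableSpace U] [BorelSpace U] [MeasurableSpace V] [BorelSpace V]

theorem map_linearEquiv_volume [FiniteDimensional ℝ V] (f : U ≃ₗ[ℝ] V) :
    (volume : Measure U).map f =
      ENNReal.ofReal ((f : U →ₗ[ℝ] V).normDet)⁻¹ • (volume : Measure V) := by
  have hpos : 0 < (f : U →ₗ[ℝ] V).normDet := normDet_pos_of_injective f.injective
  have hfm : Measurable f := (f : U →ₗ[ℝ] V).continuous_of_finiteDimensional.measurable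
  ext s hs
  have h := LinearMap.euclideanHausdorffMeasure_image_eq_normDet_mul_volume (f : U →ₗ[ℝ] V)
    (f ⁻¹' s)
  rw [f.finrank_eq, InnerProductSpace.euclideanHausdorffMeasure_eq_volume,
    LinearEquiv.coe_coe, Set.image_preimage_eq _ f.surjective] at h
  rw [Measure.map_apply hfm hs, Measure.smul_apply, smul_eq_mul, h, ← mul_assoc,
    ← ENNReal.ofReal_mul (by positivity), inv_mul_cancel₀ hpos.ne', ENNReal.ofReal_one, one_mul]

/-- The Gaussian integral of `exp (-‖f x‖² / 2)` for an injective linear map `f`. -/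
theorem integral_exp_neg_half_sq_norm {f : U →ₗ[ℝ] V} (hf : Function.Injective f) :
    Integrable (fun x => Real.exp (-(1 / 2 * ‖f x‖ ^ 2))) ∧
    ∫ x, Real.exp (-(1 / 2 * ‖f x‖ ^ 2)) =
      (2 * Real.pi) ^ ((Module.finrank ℝ U : ℝ) / 2) / f.normDet := by
  let e := LinearEquiv.ofInjective f hf
  have hpos := normDet_pos_of_injective hf
  have hmap := map_linearEquiv_volume e
  rw [normDet_ofInjective hf] at hmap
  have hem : Measurable e := e.toContinuousLinearEquiv.continuous.measurable
  let h : LinearMap.range f → ℝ := fun y => Real.exp (-(1 / 2) * ‖y‖ ^ 2)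
  have hhm : AEStronglyMeasurable h ((volume : Measure U).map e) :=
    (show Continuous h by fun_prop).aestronglyMeasurable
  have hcomp : (fun x => Real.exp (-(1 / 2 * ‖f x‖ ^ 2))) = h ∘ e := by
    ext x
    simp only [h, Function.comp, neg_mul]
    rfl
  have hval : ∫ y, h y = (Real.pi / (1 / 2)) ^ ((Module.finrank ℝ (LinearMap.range f) : ℝ) / 2) :=
    GaussianFourier.integral_rexp_neg_mul_sq_norm (by norm_num)
  have hint : Integrable h := by
    apply Integrable.of_integral_ne_zero
    rw [hval]
    positivity
  constructor
  · rw [hcomp, ← integrable_map_measure hhm hem.aemeasurable, hmap]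
    exact hint.smul_measure ENNReal.ofReal_ne_top
  · have : ∫ x, Real.exp (-(1 / 2 * ‖f x‖ ^ 2)) = ∫ x, h (e x) := by
      congr 1
    rw [this, ← integral_map hem.aemeasurable hhm, hmap, integral_smul_measure, hval,
      ENNReal.toReal_ofReal (by positivity), ← e.finrank_eq, smul_eq_mul, div_eq_inv_mul _ f.normDet]
    congr 2
    ring

variable [FiniteDimensional ℝ V]

/-- Coordinates `(s, v) ↦ w s + v` adapted to the range of an injective linear map `w` and its
orthogonal complement. -/
def orthogonalCoordinates {w : U →ₗ[ℝ] V} (hw : Function.Injective w) :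
    U × (LinearMap.range w)ᗮ ≃ᵐ V :=
  (MeasurableEquiv.prodCongr
    (LinearEquiv.ofInjective w hw).toContinuousLinearEquiv.toHomeomorph.toMeasurableEquiv
    (MeasurableEquiv.refl _)).trans ((LinearMap.range w).measurableEquivProd (0 : V)).symm

theorem orthogonalCoordinates_apply {w : U →ₗ[ℝ] V} (hw : Function.Injective w)
    (x : U × (LinearMap.range w)ᗮ) : orthogonalCoordinates hw x = w x.1 + x.2 := by
  simp [orthogonalCoordinates]
  rfl

/-- The splitting of V into a subspace and its orthogonal complement preserves volume, so only w : U
→ range w contributes a Jacobian. -/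
theorem map_orthogonalCoordinates {w : U →ₗ[ℝ] V} (hw : Function.Injective w) :
    (volume : Measure (U × (LinearMap.range w)ᗮ)).map (orthogonalCoordinates hw) =
      ENNReal.ofReal (w.normDet)⁻¹ • (volume : Measure V) := by
  have h1 := (LinearMap.range w).measurePreserving_measurableEquivProd (0 : V)
  rw [InnerProductSpace.euclideanHausdorffMeasure_eq_volume] at h1
  have h2 : MeasurePreserving (LinearEquiv.ofInjective w hw)
      (volume : Measure U) (ENNReal.ofReal (w.normDet)⁻¹ • volume) := by
    refine ⟨(LinearEquiv.ofInjective w hw).toContinuousLinearEquiv.continuous.measurable, ?_⟩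
    rw [map_linearEquiv_volume, normDet_ofInjective hw]
  have h3 := h2.prod (MeasurePreserving.id (volume : Measure (LinearMap.range w)ᗮ))
  rw [Measure.prod_smul_left] at h3
  have h4 := (h1.symm.smul_measure (ENNReal.ofReal (w.normDet)⁻¹)).comp h3
  exact h4.map_eq

end ChangeOfVariables

/-! ### The right inverse Aᵀ(AAᵀ)⁻¹ and its Jacobian. -/

section RightInverse

variable {R ι : Type*} [Fintype R] [DecidableEq R] [Fintype ι]

theorem normDet_toEuclideanLin_sq (W : Matrix ι R ℝ) :
    (Matrix.toEuclideanLin W).normDet ^ 2 = (Wᵀ * W).det := by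
  have h := LinearMap.normDet_sq_eq_det_gram (Matrix.toEuclideanLin W)
    (EuclideanSpace.basisFun R ℝ)
  rw [RCLike.ofReal_real_eq_id, id] at h
  rw [h]
  congr 1
  ext r s
  simp [Matrix.gram, Matrix.mul_apply, PiLp.inner_apply, Matrix.mulVec_single, mul_comm]

/-- The right inverse of `A` with values orthogonal to the kernel of `A`. -/
def rightInv (A : Matrix R ι ℝ) : EuclideanSpace ℝ R →ₗ[ℝ] EuclideanSpace ℝ ι :=
  Matrix.toEuclideanLin (Aᵀ * (A * Aᵀ)⁻¹)

variable {A : Matrix R ι ℝ}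

theorem sum_mul_rightInv (hA : (A * Aᵀ).det ≠ 0) (s : EuclideanSpace ℝ R) (r : R) :
    ∑ j, A r j * rightInv A s j = s r := by
  change (A *ᵥ ((Aᵀ * (A * Aᵀ)⁻¹) *ᵥ s.ofLp)) r = s r
  rw [Matrix.mulVec_mulVec, ← Matrix.mul_assoc, Matrix.mul_nonsing_inv _ (Ne.isUnit hA),
    Matrix.one_mulVec]

theorem rightInv_injective (hA : (A * Aᵀ).det ≠ 0) : Function.Injective (rightInv A) := by
  intro s t h
  ext r
  rw [← sum_mul_rightInv hA s r, h, sum_mul_rightInv hA]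

theorem mem_range_rightInv_orthogonal (hA : (A * Aᵀ).det ≠ 0) (v : EuclideanSpace ℝ ι) :
    v ∈ (LinearMap.range (rightInv A))ᗮ ↔ ∀ r, ∑ j, A r j * v j = 0 := by
  have key : ∀ s : EuclideanSpace ℝ R, inner ℝ (rightInv A s) v =
      ((A * Aᵀ)⁻¹ *ᵥ s.ofLp) ⬝ᵥ (A *ᵥ v.ofLp) := by
    intro s
    rw [EuclideanSpace.inner_eq_star_dotProduct, star_trivial]
    change v.ofLp ⬝ᵥ ((Aᵀ * (A * Aᵀ)⁻¹) *ᵥ s.ofLp) = _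
    rw [← Matrix.mulVec_mulVec, Matrix.dotProduct_mulVec, Matrix.vecMul_transpose, dotProduct_comm]
  have hkey : (∀ r, ∑ j, A r j * v j = 0) ↔ A *ᵥ v.ofLp = 0 := by
    rw [funext_iff]; rfl
  rw [hkey, Submodule.mem_orthogonal]
  constructor
  · intro h
    -- The vector is chosen so that its pairing with v is |Av|².
    have h1 := h _ (LinearMap.mem_range_self (rightInv A)
      (WithLp.toLp 2 ((A * Aᵀ) *ᵥ (A *ᵥ v.ofLp))))
    rw [key, Matrix.mulVec_mulVec, Matrix.nonsing_inv_mul _ (Ne.isUnit hA),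
      Matrix.one_mulVec] at h1
    exact dotProduct_self_eq_zero.1 h1
  · rintro h _ ⟨s, rfl⟩
    rw [key, h, dotProduct_zero]

theorem det_mul_transpose_nonneg (A : Matrix R ι ℝ) : 0 ≤ (A * Aᵀ).det := by
  have := normDet_toEuclideanLin_sq Aᵀ
  rw [Matrix.transpose_transpose] at this
  rw [← this]
  positivity

/-- For W = Aᵀ(AAᵀ)⁻¹ one has WᵀW = (AAᵀ)⁻¹. -/
theorem normDet_rightInv (hA : (A * Aᵀ).det ≠ 0) :
    (rightInv A).normDet = (Real.sqrt (A * Aᵀ).det)⁻¹ := by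
  have h := normDet_toEuclideanLin_sq (Aᵀ * (A * Aᵀ)⁻¹)
  have hu : IsUnit (A * Aᵀ).det := Ne.isUnit hA
  have hT : (A * Aᵀ)ᵀ = A * Aᵀ := by rw [Matrix.transpose_mul, Matrix.transpose_transpose]
  rw [Matrix.transpose_mul, Matrix.transpose_transpose, Matrix.transpose_nonsing_inv, hT,
    Matrix.mul_assoc, ← Matrix.mul_assoc A, Matrix.mul_nonsing_inv _ hu, Matrix.mul_one,
    Matrix.det_nonsing_inv, Ring.inverse_eq_inv'] at h
  rw [← Real.sqrt_inv, ← h, Real.sqrt_sq (LinearMap.normDet_nonneg _)]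
  rfl

theorem finrank_range_rightInv_orthogonal (hA : (A * Aᵀ).det ≠ 0) :
    Module.finrank ℝ (LinearMap.range (rightInv A))ᗮ = Fintype.card ι - Fintype.card R := by
  have h1 := (LinearMap.range (rightInv A)).finrank_add_finrank_orthogonal
  rw [LinearMap.finrank_range_of_inj (rightInv_injective hA), finrank_euclideanSpace,
    finrank_euclideanSpace] at h1
  omega

end RightInverse

/-! ### Exponential densities and their characteristic functions. -/

section ExponentialDensity

/-- The density of the exponential distribution of mean `ζ`. -/
def expDensity (ζ x : ℝ) : ℝ := if 0 ≤ x then ζ⁻¹ * Real.exp (-(x / ζ)) else 0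

theorem expDensity_nonneg {ζ : ℝ} (hζ : 0 < ζ) (x : ℝ) : 0 ≤ expDensity ζ x := by
  unfold expDensity
  split_ifs <;> positivity

theorem expDensity_le {ζ : ℝ} (hζ : 0 < ζ) (x : ℝ) : expDensity ζ x ≤ ζ⁻¹ := by
  unfold expDensity
  split_ifs with h
  · exact mul_le_of_le_one_right (by positivity)
      (Real.exp_le_one_iff.2 (neg_nonpos.2 (by positivity)))
  · positivity

theorem measurable_expDensity (ζ : ℝ) : Measurable (expDensity ζ) := by
  unfold expDensity
  exact Measurable.ite measurableSet_Ici (by fun_prop) measurable_const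

theorem continuousAt_expDensity (ζ : ℝ) {x : ℝ} (hx : x ≠ 0) :
    ContinuousAt (expDensity ζ) x := by
  rcases hx.lt_or_gt with h | h
  · refine (continuousAt_const (y := (0 : ℝ))).congr ?_
    filter_upwards [Iio_mem_nhds h] with y hy
    rw [expDensity, if_neg (not_le.2 hy)]
  · refine (show ContinuousAt (fun x => ζ⁻¹ * Real.exp (-(x / ζ))) x by fun_prop).congr ?_
    filter_upwards [Ioi_mem_nhds h] with y hy
    rw [expDensity, if_pos (le_of_lt hy)]

theorem integral_exp_mul_expDensity {ζ : ℝ} (hζ : 0 < ζ) (c : ℝ) :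
    Integrable (fun x : ℝ => Complex.exp (-(Complex.I * (c * x : ℝ))) * (expDensity ζ x : ℂ)) ∧
    ∫ x : ℝ, Complex.exp (-(Complex.I * (c * x : ℝ))) * (expDensity ζ x : ℂ) =
      1 / (1 + Complex.I * (ζ * c : ℝ)) := by
  set a : ℂ := -((ζ : ℂ)⁻¹ + Complex.I * c) with ha
  have hre : a.re < 0 := by
    have : a.re = -ζ⁻¹ := by
      rw [ha, ← Complex.ofReal_inv]; simp
    rw [this]
    exact neg_neg_of_pos (by positivity)
  have heq : (fun x : ℝ => Complex.exp (-(Complex.I * (c * x : ℝ))) * (expDensity ζ x : ℂ)) =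
      (Set.Ici (0 : ℝ)).indicator fun x : ℝ => (ζ : ℂ)⁻¹ * Complex.exp (a * x) := by
    ext x
    by_cases hx : 0 ≤ x
    · rw [Set.indicator_of_mem (show x ∈ Set.Ici 0 from hx), expDensity, if_pos hx]
      push_cast
      rw [mul_left_comm, ← Complex.exp_add, ha]
      congr 2
      ring
    · rw [Set.indicator_of_notMem (show x ∉ Set.Ici 0 from hx), expDensity, if_neg hx]
      simp
  rw [heq]
  constructor
  · rw [integrable_indicator_iff measurableSet_Ici, integrableOn_Ici_iff_integrableOn_Ioi]
    exact (integrableOn_exp_mul_complex_Ioi hre 0).const_mul _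
  · rw [integral_indicator measurableSet_Ici, integral_Ici_eq_integral_Ioi, integral_const_mul,
      integral_exp_mul_complex_Ioi hre]
    have h1 := one_add_I_mul_ne_zero (ζ * c)
    have hζ' : (ζ : ℂ) ≠ 0 := by exact_mod_cast hζ.ne'
    have h2 : a = -((ζ : ℂ)⁻¹ * (1 + Complex.I * (ζ * c : ℝ))) := by
      rw [ha]; push_cast; field_simp
    rw [h2]
    simp only [Complex.ofReal_zero, mul_zero, Complex.exp_zero]
    field_simp

variable {ι : Type*} [Fintype ι]

/-- The joint density of independent exponential variables of means `z j`. -/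
def expDensityProd (z x : EuclideanSpace ℝ ι) : ℝ := ∏ j, expDensity (z j) (x j)

theorem measurable_expDensityProd (z : EuclideanSpace ℝ ι) : Measurable (expDensityProd z) := by
  unfold expDensityProd
  exact Finset.measurable_fun_prod _ fun j _ => (measurable_expDensity _).comp (by fun_prop)

theorem expDensityProd_nonneg {z : EuclideanSpace ℝ ι} (hz : ∀ j, 0 < z j)
    (x : EuclideanSpace ℝ ι) : 0 ≤ expDensityProd z x :=
  Finset.prod_nonneg fun j _ => expDensity_nonneg (hz j) _

theorem expDensityProd_le {z : EuclideanSpace ℝ ι} (hz : ∀ j, 0 < z j)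
    (x : EuclideanSpace ℝ ι) : expDensityProd z x ≤ ∏ j, (z j)⁻¹ :=
  Finset.prod_le_prod (fun j _ => expDensity_nonneg (hz j) _) fun j _ => expDensity_le (hz j) _

theorem expDensityProd_eq {z x : EuclideanSpace ℝ ι} (hx : ∀ j, 0 ≤ x j) :
    expDensityProd z x = (∏ j, (z j)⁻¹) * Real.exp (-∑ j, x j / z j) := by
  rw [expDensityProd, ← Finset.sum_neg_distrib, Real.exp_sum, ← Finset.prod_mul_distrib]
  exact Finset.prod_congr rfl fun j _ => by rw [expDensity, if_pos (hx j)]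

theorem expDensityProd_eq_zero {z x : EuclideanSpace ℝ ι} (hx : ¬ ∀ j, 0 ≤ x j) :
    expDensityProd z x = 0 := by
  push Not at hx
  obtain ⟨j, hj⟩ := hx
  exact Finset.prod_eq_zero (Finset.mem_univ j) (by rw [expDensity, if_neg (not_le.2 hj)])

/-- The characteristic function of a vector of independent exponential variables. -/
theorem integral_exp_mul_expDensityProd {z : EuclideanSpace ℝ ι} (hz : ∀ j, 0 < z j)
    (c : ι → ℝ) :
    Integrable (fun x : EuclideanSpace ℝ ι =>
      Complex.exp (-(Complex.I * (∑ j, c j * x j : ℝ))) * (expDensityProd z x : ℂ)) ∧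
    ∫ x : EuclideanSpace ℝ ι,
      Complex.exp (-(Complex.I * (∑ j, c j * x j : ℝ))) * (expDensityProd z x : ℂ) =
      ∏ j, 1 / (1 + Complex.I * (z j * c j : ℝ)) := by
  have hprod : ∀ x : EuclideanSpace ℝ ι,
      Complex.exp (-(Complex.I * (∑ j, c j * x j : ℝ))) * (expDensityProd z x : ℂ) =
      ∏ j, Complex.exp (-(Complex.I * (c j * x j : ℝ))) * (expDensity (z j) (x j) : ℂ) := by
    intro x
    rw [Finset.prod_mul_distrib, ← Complex.exp_sum, expDensityProd, Complex.ofReal_prod,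
      Finset.sum_neg_distrib, ← Finset.mul_sum, Complex.ofReal_sum]
  simp_rw [hprod]
  have hmp := PiLp.volume_preserving_ofLp ι
  have hemb : MeasurableEmbedding (WithLp.ofLp : EuclideanSpace ℝ ι → ι → ℝ) :=
    (MeasurableEquiv.toLp 2 (ι → ℝ)).symm.measurableEmbedding
  constructor
  · exact (hmp.integrable_comp_emb hemb).2 (Integrable.fintype_prod (f := fun j (y : ℝ) =>
      Complex.exp (-(Complex.I * (c j * y : ℝ))) * (expDensity (z j) y : ℂ))
      fun j => (integral_exp_mul_expDensity (hz j) (c j)).1)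
  · refine (hmp.integral_comp hemb (fun y : ι → ℝ =>
      ∏ j, Complex.exp (-(Complex.I * (c j * y j : ℝ))) * (expDensity (z j) (y j) : ℂ))).trans ?_
    rw [integral_fintype_prod_volume_eq_prod (fun j (y : ℝ) =>
      Complex.exp (-(Complex.I * (c j * y : ℝ))) * (expDensity (z j) y : ℂ))]
    exact Finset.prod_congr rfl fun j _ => (integral_exp_mul_expDensity (hz j) (c j)).2

end ExponentialDensity

/-! ### Fubini along the fibres. -/

section OrthogonalIntegral

variable {U V : Type*} [NormedAddCommGroup U] [InnerProductSpace ℝ U] [FiniteDimensional ℝ U]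
  [NormedAddCommGroup V] [InnerProductSpace ℝ V] [FiniteDimensional ℝ V]
  [MeasurableSpace U] [BorelSpace U] [MeasurableSpace V] [BorelSpace V]

theorem integrable_comp_orthogonalCoordinates {w : U →ₗ[ℝ] V} (hw : Function.Injective w)
    {H : V → ℂ} (hH : Integrable H) :
    Integrable (fun x : U × (LinearMap.range w)ᗮ => H (w x.1 + x.2)) (volume.prod volume) := by
  have h1 : Integrable H ((volume : Measure (U × (LinearMap.range w)ᗮ)).map
      (orthogonalCoordinates hw)) := by
    rw [map_orthogonalCoordinates hw]
    exact hH.smul_measure ENNReal.ofReal_ne_top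
  have h2 := h1.comp_measurable (orthogonalCoordinates hw).measurable
  refine h2.congr (Eventually.of_forall fun x => ?_)
  simp only [Function.comp, orthogonalCoordinates_apply]

theorem integral_integral_orthogonalCoordinates {w : U →ₗ[ℝ] V} (hw : Function.Injective w)
    {H : V → ℂ} (hH : Integrable H) :
    ∫ s : U, ∫ v : (LinearMap.range w)ᗮ, H (w s + v) = (w.normDet)⁻¹ • ∫ x, H x := by
  rw [← integral_prod _ (integrable_comp_orthogonalCoordinates hw hH)]
  have h1 := integral_map_equiv (μ := (volume : Measure (U × (LinearMap.range w)ᗮ)))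
    (orthogonalCoordinates hw) H
  simp only [orthogonalCoordinates_apply] at h1
  rw [map_orthogonalCoordinates hw, integral_smul_measure,
    ENNReal.toReal_ofReal (inv_nonneg.2 w.normDet_nonneg)] at h1
  exact h1.symm

end OrthogonalIntegral

/-! ### Volume as a Fourier integral. -/

section Slice

variable {R ι : Type*} [Fintype R]

/-- The linear functional `ξ ↦ 2π z_j ⟨a_j, ξ⟩`. -/
def columnForm (A : Matrix R ι ℝ) (z : EuclideanSpace ℝ ι) (j : ι) :
    EuclideanSpace ℝ R →ₗ[ℝ] ℝ where
  toFun ξ := 2 * Real.pi * z j * ∑ r, A r j * ξ r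
  map_add' ξ η := by simp [mul_add, Finset.sum_add_distrib]
  map_smul' c ξ := by
    simp only [PiLp.smul_apply, smul_eq_mul, RingHom.id_apply, Finset.mul_sum]
    exact Finset.sum_congr rfl fun r _ => by ring

theorem columnForm_apply (A : Matrix R ι ℝ) (z : EuclideanSpace ℝ ι) (j : ι)
    (ξ : EuclideanSpace ℝ R) : columnForm A z j ξ = 2 * Real.pi * z j * ∑ r, A r j * ξ r := rfl

variable [Fintype ι]

/-- A maximum of the entropy satisfies the first order condition. -/
theorem IsAnalyticCenter.sum_div_eq_zero {R : Type*} {A : Matrix R ι ℝ}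
    {z : EuclideanSpace ℝ ι} {b : R → ℝ} (h : IsAnalyticCenter (polyhedron A b) z) (v : EuclideanSpace ℝ ι)
    (hv : ∀ r, ∑ j, A r j * v j = 0) : ∑ j, v j / z j = 0 := by
  obtain ⟨hP, hz, hmax⟩ := h
  have hpos : ∀ᶠ ε : ℝ in 𝓝 0, ∀ j, 0 < (z + ε • v) j := by
    rw [eventually_all]
    intro j
    have hcont : ContinuousAt (fun ε : ℝ => (z + ε • v) j) 0 := by
      simp only [PiLp.add_apply, PiLp.smul_apply]; fun_prop
    exact hcont.eventually_const_lt (by simpa using hz j)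
  -- All coordinates of z are positive, so the line z + εv stays in the polyhedron for small ε of
  -- either sign.
  have hloc : IsLocalMax (fun ε : ℝ => entropy (z + ε • v)) 0 := by
    filter_upwards [hpos] with ε hε
    simp only [zero_smul, add_zero]
    refine hmax _ ⟨fun r => ?_, fun j => (hε j).le⟩ hε
    simp only [PiLp.add_apply, PiLp.smul_apply, smul_eq_mul, mul_add, Finset.sum_add_distrib]
    have : ∑ j, A r j * (ε * v j) = ε * ∑ j, A r j * v j := by
      rw [Finset.mul_sum]; exact Finset.sum_congr rfl fun j _ => by ring
    rw [this, hv, mul_zero, add_zero, hP.1]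
  have hder : HasDerivAt (fun ε : ℝ => entropy (z + ε • v)) (∑ j, v j / z j) 0 := by
    unfold entropy
    refine HasDerivAt.const_add _ (HasDerivAt.fun_sum fun j _ => ?_)
    have h1 : HasDerivAt (fun ε : ℝ => (z + ε • v) j) (v j) 0 := by
      simpa using ((hasDerivAt_id (0 : ℝ)).mul_const (v j)).const_add (z j)
    have h2 := h1.log (by simpa using (hz j).ne')
    simpa using h2
  exact hloc.hasDerivAt_eq_zero hder

variable [DecidableEq R]

/-- The integral of the exponential density over the fibre `{x : A x = s}`. -/
def sliceDensity (A : Matrix R ι ℝ) (z : EuclideanSpace ℝ ι) (s : EuclideanSpace ℝ R) : ℂ :=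
  ∫ v : (LinearMap.range (rightInv A))ᗮ, (expDensityProd z (rightInv A s + v) : ℂ)

variable {A : Matrix R ι ℝ} {z : EuclideanSpace ℝ ι}

theorem integrable_expDensityProd (hz : ∀ j, 0 < z j) :
    Integrable (fun x => (expDensityProd z x : ℂ)) := by
  simpa using (integral_exp_mul_expDensityProd hz 0).1

theorem integrable_sliceDensity (hA : (A * Aᵀ).det ≠ 0) (hz : ∀ j, 0 < z j) :
    Integrable (sliceDensity A z) :=
  (integrable_comp_orthogonalCoordinates (rightInv_injective hA)
    (integrable_expDensityProd hz)).integral_prod_left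

theorem sum_mul_rightInv_add (hA : (A * Aᵀ).det ≠ 0) (s : EuclideanSpace ℝ R)
    (v : (LinearMap.range (rightInv A))ᗮ) (r : R) :
    ∑ j, A r j * (rightInv A s + (v : EuclideanSpace ℝ ι)) j = s r := by
  simp only [PiLp.add_apply, mul_add, Finset.sum_add_distrib]
  rw [sum_mul_rightInv hA, (mem_range_rightInv_orthogonal hA _).1 v.2 r, add_zero]

/-- The phase depends only on Ax, hence is constant on fibres; Fubini reassembles the characteristic
function of the whole exponential vector, and √det AAᵀ is the Jacobian. -/
theorem fourier_sliceDensity (hA : (A * Aᵀ).det ≠ 0) (hz : ∀ j, 0 < z j)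
    (ξ : EuclideanSpace ℝ R) :
    FourierTransform.fourier (sliceDensity A z) ξ =
      (Real.sqrt (A * Aᵀ).det : ℂ) * ∏ j, 1 / (1 + Complex.I * columnForm A z j ξ) := by
  set c : ι → ℝ := fun j => 2 * Real.pi * ∑ r, A r j * ξ r with hc
  obtain ⟨hi, hv⟩ := integral_exp_mul_expDensityProd hz c
  have hphase : ∀ s (v : (LinearMap.range (rightInv A))ᗮ),
      ∑ j, c j * (rightInv A s + (v : EuclideanSpace ℝ ι)) j = 2 * Real.pi * inner ℝ s ξ := by
    intro s v
    simp only [hc, PiLp.inner_apply, RCLike.inner_apply, conj_trivial]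
    simp only [← sum_mul_rightInv_add hA s v, Finset.mul_sum, Finset.sum_mul]
    rw [Finset.sum_comm]
    exact Finset.sum_congr rfl fun r _ => Finset.sum_congr rfl fun j _ => by ring
  rw [Real.fourier_eq']
  have h1 : ∀ s : EuclideanSpace ℝ R,
      Complex.exp (((-2 * Real.pi * inner ℝ s ξ : ℝ) : ℂ) * Complex.I) • sliceDensity A z s =
      ∫ v : (LinearMap.range (rightInv A))ᗮ,
        Complex.exp (-(Complex.I * (∑ j, c j * (rightInv A s + (v : EuclideanSpace ℝ ι)) j : ℝ))) *
          (expDensityProd z (rightInv A s + v) : ℂ) := by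
    intro s
    rw [sliceDensity, smul_eq_mul, ← integral_const_mul]
    congr 1
    ext v
    rw [hphase]
    congr 2
    push_cast
    ring
  simp_rw [h1]
  rw [integral_integral_orthogonalCoordinates (rightInv_injective hA)
    (H := fun x => Complex.exp (-(Complex.I * (∑ j, c j * x j : ℝ))) * (expDensityProd z x : ℂ))
    hi, hv, normDet_rightInv hA, inv_inv, Complex.real_smul]
  congr 1
  refine Finset.prod_congr rfl fun j _ => ?_
  rw [columnForm_apply, hc]
  congr 4
  ring

/-- Pointwise Fourier inversion needs continuity at b. The functional ∑ x_j/z_j is constant on each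
fibre, so the nonnegative parts of nearby fibres lie in one ball and dominated convergence applies.
The integrand is discontinuous only where a coordinate vanishes. -/
theorem continuousAt_sliceDensity (hA : (A * Aᵀ).det ≠ 0) (hz : ∀ j, 0 < z j)
    (hfirst : ∀ v : EuclideanSpace ℝ ι, (∀ r, ∑ j, A r j * v j = 0) → ∑ j, v j / z j = 0)
    {b : EuclideanSpace ℝ R} (hb : ∀ r, ∑ j, A r j * z j = b r) :
    ContinuousAt (sliceDensity A z) b := by
  have hwc : Continuous (rightInv A) := (rightInv A).continuous_of_finiteDimensional
  set l : EuclideanSpace ℝ ι → ℝ := fun x => ∑ j, x j / z j with hl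
  have hlc : Continuous l := by rw [hl]; fun_prop
  have hladd : ∀ s (v : (LinearMap.range (rightInv A))ᗮ),
      l (rightInv A s + v) = l (rightInv A s) := by
    intro s v
    simp only [hl, PiLp.add_apply, add_div, Finset.sum_add_distrib]
    rw [hfirst v ((mem_range_rightInv_orthogonal hA _).1 v.2), add_zero]
  set ρ : ℝ := l (rightInv A b) + 1 with hρ
  set r₀ : ℝ := (∑ j, z j * ρ) + (‖rightInv A b‖ + 1) with hr₀
  set C : ℝ := ∏ j, (z j)⁻¹ with hC
  have hev : ∀ᶠ s in 𝓝 b, l (rightInv A s) < ρ ∧ ‖rightInv A s‖ < ‖rightInv A b‖ + 1 :=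
    ((hlc.comp hwc).continuousAt.eventually_lt_const (lt_add_one _)).and
      ((hwc.norm).continuousAt.eventually_lt_const (lt_add_one _))
  refine continuousAt_of_dominated
    (bound := (Metric.closedBall (0 : (LinearMap.range (rightInv A))ᗮ) r₀).indicator fun _ => C)
    ?_ ?_ ?_ ?_
  · refine Eventually.of_forall fun s => ?_
    exact (Complex.measurable_ofReal.comp ((measurable_expDensityProd z).comp
      (by fun_prop))).aestronglyMeasurable
  · filter_upwards [hev] with s hs
    refine Eventually.of_forall fun v => ?_
    have hC0 : 0 ≤ C := Finset.prod_nonneg fun j _ => inv_nonneg.2 (hz j).le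
    rw [Complex.norm_real, Real.norm_of_nonneg (expDensityProd_nonneg hz _)]
    by_cases hx : ∀ j, 0 ≤ (rightInv A s + (v : EuclideanSpace ℝ ι)) j
    · have hmem : v ∈ Metric.closedBall (0 : (LinearMap.range (rightInv A))ᗮ) r₀ := by
        rw [mem_closedBall_zero_iff]
        have h1 : ∀ j, (rightInv A s + (v : EuclideanSpace ℝ ι)) j ≤ z j * ρ := by
          intro j
          have h2 : (rightInv A s + (v : EuclideanSpace ℝ ι)) j / z j ≤
              l (rightInv A s + (v : EuclideanSpace ℝ ι)) :=
            Finset.single_le_sum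
              (f := fun j => (rightInv A s + (v : EuclideanSpace ℝ ι)) j / z j)
              (fun i _ => div_nonneg (hx i) (hz i).le) (Finset.mem_univ j)
          rw [hladd, div_le_iff₀ (hz j)] at h2
          nlinarith [hz j, hs.1]
        have h3 : ‖rightInv A s + (v : EuclideanSpace ℝ ι)‖ ≤ ∑ j, z j * ρ := by
          refine le_trans ?_ (Finset.sum_le_sum fun j _ => h1 j)
          rw [EuclideanSpace.norm_eq, Real.sqrt_le_left (Finset.sum_nonneg fun j _ => hx j)]
          simp only [Real.norm_eq_abs, sq_abs]
          exact Finset.sum_sq_le_sq_sum_of_nonneg fun j _ => hx j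
        have h4 : (v : EuclideanSpace ℝ ι) =
            (rightInv A s + (v : EuclideanSpace ℝ ι)) - rightInv A s := by abel
        calc ‖v‖ = ‖(v : EuclideanSpace ℝ ι)‖ := rfl
          _ ≤ ‖rightInv A s + (v : EuclideanSpace ℝ ι)‖ + ‖rightInv A s‖ := by
              conv_lhs => rw [h4]
              exact norm_sub_le _ _
          _ ≤ r₀ := by rw [hr₀]; linarith [hs.2]
      rw [Set.indicator_of_mem hmem]
      exact expDensityProd_le hz _
    · rw [expDensityProd_eq_zero hx]
      exact Set.indicator_nonneg (fun _ _ => hC0) _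
  · rw [integrable_indicator_iff Metric.isClosed_closedBall.measurableSet]
    exact integrableOn_const (isCompact_closedBall _ _).measure_lt_top.ne
  · have hnull : ∀ j, ∀ᵐ v : (LinearMap.range (rightInv A))ᗮ,
        (rightInv A b + (v : EuclideanSpace ℝ ι)) j ≠ 0 := by
      intro j
      let H : AffineSubspace ℝ (LinearMap.range (rightInv A))ᗮ :=
        { carrier := {v | (rightInv A b + (v : EuclideanSpace ℝ ι)) j = 0}
          smul_vsub_vadd_mem' := by
            intro c p₁ p₂ p₃ h₁ h₂ h₃
            simp only [Set.mem_ofPred_eq, PiLp.add_apply] at h₁ h₂ h₃ ⊢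
            simp only [vsub_eq_sub, vadd_eq_add, Submodule.coe_add, Submodule.coe_smul,
              Submodule.coe_sub, PiLp.add_apply, PiLp.smul_apply, PiLp.sub_apply, smul_eq_mul]
            linear_combination h₃ + c * h₁ - c * h₂ }
      have hH : H ≠ ⊤ := by
        intro htop
        have hmem : z - rightInv A b ∈ (LinearMap.range (rightInv A))ᗮ := by
          rw [mem_range_rightInv_orthogonal hA]
          intro r
          simp only [PiLp.sub_apply, mul_sub, Finset.sum_sub_distrib]
          rw [hb, sum_mul_rightInv hA, sub_self]
        have h0 : (⟨_, hmem⟩ : (LinearMap.range (rightInv A))ᗮ) ∈ H := by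
          rw [htop]; exact AffineSubspace.mem_top _ _ _
        have h1 : (rightInv A b + (z - rightInv A b)) j = 0 := h0
        rw [add_sub_cancel] at h1
        exact (hz j).ne' h1
      exact measure_eq_zero_iff_ae_notMem.1 (Measure.addHaar_affineSubspace volume H hH)
    filter_upwards [ae_all_iff.2 hnull] with v hv
    refine Complex.continuous_ofReal.continuousAt.comp ?_
    unfold expDensityProd
    refine tendsto_finsetProd _ fun j _ => ?_
    have h1 : ContinuousAt (fun s => (rightInv A s + (v : EuclideanSpace ℝ ι)) j) b := by
      fun_prop
    exact ContinuousAt.comp (g := expDensity (z j)) (continuousAt_expDensity (z j) (hv j)) h1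

/-- By the first order condition ∑ x_j/z_j keeps on the fibre its value at z, the number of
coordinates; the density on P is therefore the constant e^{-f(z)}. -/
theorem sliceDensity_eq_vol (hA : (A * Aᵀ).det ≠ 0) (hz : ∀ j, 0 < z j)
    (hfirst : ∀ v : EuclideanSpace ℝ ι, (∀ r, ∑ j, A r j * v j = 0) → ∑ j, v j / z j = 0)
    {b : EuclideanSpace ℝ R} (hb : ∀ r, ∑ j, A r j * z j = b r) :
    sliceDensity A z b = Real.exp (-entropy z) *
      vol (Fintype.card ι - Fintype.card R) (polyhedron A b) := by
  set S : Set (LinearMap.range (rightInv A))ᗮ :=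
    {v | ∀ j, 0 ≤ (rightInv A b + (v : EuclideanSpace ℝ ι)) j} with hS
  have himage : polyhedron A b =
      (fun v : (LinearMap.range (rightInv A))ᗮ => rightInv A b + (v : EuclideanSpace ℝ ι)) '' S := by
    ext x
    constructor
    · rintro ⟨h1, h2⟩
      have hmem : x - rightInv A b ∈ (LinearMap.range (rightInv A))ᗮ := by
        rw [mem_range_rightInv_orthogonal hA]
        intro r
        simp only [PiLp.sub_apply, mul_sub, Finset.sum_sub_distrib]
        rw [h1, sum_mul_rightInv hA, sub_self]
      refine ⟨⟨_, hmem⟩, fun j => ?_, ?_⟩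
      · simpa using h2 j
      · simp
    · rintro ⟨v, hv, rfl⟩
      exact ⟨sum_mul_rightInv_add hA b v, hv⟩
  have hiso : Isometry (fun v : (LinearMap.range (rightInv A))ᗮ =>
      rightInv A b + (v : EuclideanSpace ℝ ι)) :=
    (IsometryEquiv.addLeft (rightInv A b)).isometry.comp isometry_subtype_coe
  have hvol : vol (Fintype.card ι - Fintype.card R) (polyhedron A b) = (volume S).toReal := by
    rw [vol, himage, hiso.euclideanHausdorffMeasure_image, ← finrank_range_rightInv_orthogonal hA,
      InnerProductSpace.euclideanHausdorffMeasure_eq_volume]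
  have hSm : MeasurableSet S := by
    rw [hS, Set.ofPred_forall]
    refine MeasurableSet.iInter fun j => ?_
    exact (isClosed_le continuous_const (by fun_prop)).measurableSet
  have hfun : (fun v : (LinearMap.range (rightInv A))ᗮ =>
      (expDensityProd z (rightInv A b + v) : ℂ)) =
      S.indicator fun _ => ((Real.exp (-entropy z) : ℝ) : ℂ) := by
    ext v
    by_cases hv : v ∈ S
    · rw [Set.indicator_of_mem hv, expDensityProd_eq hv]
      congr 1
      have hsum : ∑ j, (rightInv A b + (v : EuclideanSpace ℝ ι)) j / z j = Fintype.card ι := by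
        have h1 := hfirst (rightInv A b + (v : EuclideanSpace ℝ ι) - z) (fun r => by
          simp only [PiLp.sub_apply, mul_sub, Finset.sum_sub_distrib]
          rw [sum_mul_rightInv_add hA, hb, sub_self])
        simp only [PiLp.sub_apply, sub_div, Finset.sum_sub_distrib] at h1
        rw [sub_eq_zero] at h1
        rw [h1]
        simp [div_self (hz _).ne']
      rw [hsum, entropy, neg_add, Real.exp_add, mul_comm, ← Finset.sum_neg_distrib, Real.exp_sum]
      congr 1
      refine Finset.prod_congr rfl fun j _ => ?_
      rw [Real.exp_neg, Real.exp_log (hz j)]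
    · rw [Set.indicator_of_notMem hv, expDensityProd_eq_zero hv, Complex.ofReal_zero]
  rw [sliceDensity, hfun, integral_indicator hSm, setIntegral_const, hvol, Complex.real_smul,
    mul_comm, measureReal_def]

/-- The volume of a polyhedron as an oscillatory integral. -/
theorem vol_polyhedron_eq_integral (hA : (A * Aᵀ).det ≠ 0) {b : R → ℝ}
    (h : IsAnalyticCenter (polyhedron A b) z) (hint : Integrable (charProd (columnForm A z))) :
    (vol (Fintype.card ι - Fintype.card R) (polyhedron A b) : ℂ) =
      Real.exp (entropy z) * Real.sqrt (A * Aᵀ).det * ∫ ξ, charProd (columnForm A z) ξ := by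
  have hz := h.2.1
  set b' : EuclideanSpace ℝ R := WithLp.toLp 2 b with hb'
  have hb : ∀ r, ∑ j, A r j * z j = b' r := h.1.1
  have hfirst := h.sum_div_eq_zero
  have hval := sliceDensity_eq_vol hA hz hfirst hb
  have hphase : ∀ ξ : EuclideanSpace ℝ R, 2 * Real.pi * inner ℝ ξ b' =
      ∑ j, columnForm A z j ξ := by
    intro ξ
    simp only [columnForm_apply, PiLp.inner_apply, RCLike.inner_apply, conj_trivial, ← hb,
      Finset.mul_sum, Finset.sum_mul]
    rw [Finset.sum_comm]
    exact Finset.sum_congr rfl fun j _ => Finset.sum_congr rfl fun r _ => by ring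
  -- Since b = Az is the mean of AX, the phase of Fourier inversion at b is the factor that centers
  -- the exponential variables.
  have hchar : ∀ ξ, Complex.exp (((2 * Real.pi * inner ℝ ξ b' : ℝ) : ℂ) * Complex.I) •
      FourierTransform.fourier (sliceDensity A z) ξ =
      (Real.sqrt (A * Aᵀ).det : ℂ) * charProd (columnForm A z) ξ := by
    intro ξ
    rw [fourier_sliceDensity hA hz, hphase, charProd, smul_eq_mul, Complex.ofReal_sum,
      Finset.sum_mul, Complex.exp_sum, mul_left_comm, ← Finset.prod_mul_distrib]
    congr 1
    refine Finset.prod_congr rfl fun j _ => ?_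
    rw [mul_one_div, mul_comm Complex.I]
  have hFint : Integrable (FourierTransform.fourier (sliceDensity A z)) := by
    have hcont : Continuous (FourierTransform.fourier (sliceDensity A z)) :=
      VectorFourier.fourierIntegral_continuous Real.continuous_fourierChar
        (by exact continuous_inner) (integrable_sliceDensity hA hz)
    refine (hint.const_mul (Real.sqrt (A * Aᵀ).det : ℂ)).mono hcont.aestronglyMeasurable
      (Eventually.of_forall fun ξ => ?_)
    rw [← hchar, smul_eq_mul, norm_mul, Complex.norm_exp_ofReal_mul_I, one_mul]
  have hinv := (integrable_sliceDensity hA hz).fourierInv_fourier_eq hFint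
    (continuousAt_sliceDensity hA hz hfirst hb)
  rw [Real.fourierInv_eq'] at hinv
  simp_rw [hchar] at hinv
  rw [integral_const_mul, hval] at hinv
  rw [mul_assoc, hinv, ← mul_assoc, ← Complex.ofReal_mul, ← Real.exp_add, add_neg_cancel,
    Real.exp_zero, Complex.ofReal_one, one_mul]

end Slice

/-! ### Rayleigh quotient. -/

section Eigenvalue

variable {R : Type*} [Fintype R] [DecidableEq R]

theorem dotProduct_toMatrix'_mulVec (Q : QuadraticForm ℝ (R → ℝ)) (t : R → ℝ) :
    t ⬝ᵥ (Q.toMatrix' *ᵥ t) = Q t := by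
  rw [← Matrix.toLinearMap₂'_apply', QuadraticForm.toMatrix', Matrix.toLinearMap₂'_toMatrix',
    QuadraticMap.associated_eq_self_apply]

/-- The smallest eigenvalue of a quadratic form is the minimum of its Rayleigh quotient. -/
theorem exists_isSmallestEigenvalue [Nonempty R] (Q : QuadraticForm ℝ (R → ℝ)) :
    ∃ l, IsSmallestEigenvalue Q l ∧ (∃ t : R → ℝ, t ≠ 0 ∧ Q t = l * ∑ r, t r ^ 2) ∧
      ∀ t : R → ℝ, l * ∑ r, t r ^ 2 ≤ Q t := by
  set M := Q.toMatrix' with hM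
  set T := Matrix.toEuclideanLin M with hT
  have hsymm : T.IsSymmetric := by
    rw [hT, Matrix.isSymmetric_toEuclideanLin_iff, Matrix.IsHermitian,
      Matrix.conjTranspose_eq_transpose_of_trivial]
    exact QuadraticForm.isSymm_toMatrix' Q
  have hTQ : ∀ x : EuclideanSpace ℝ R, inner ℝ (T x) x = Q x.ofLp := by
    intro x
    rw [EuclideanSpace.inner_eq_star_dotProduct, star_trivial]
    exact dotProduct_toMatrix'_mulVec Q _
  have heig : ∀ μ (x : R → ℝ), M *ᵥ x = μ • x → Q x = μ * ∑ r, x r ^ 2 := by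
    intro μ x hx
    rw [← dotProduct_toMatrix'_mulVec, ← hM, hx, dotProduct_smul, smul_eq_mul, dotProduct]
    simp only [sq]
  have hnorm : ∀ x : EuclideanSpace ℝ R, ‖x‖ ^ 2 = ∑ r, x.ofLp r ^ 2 := by
    intro x
    rw [EuclideanSpace.norm_sq_eq]
    simp
  obtain ⟨x, hx⟩ := (hsymm.hasEigenvalue_iInf_of_finiteDimensional).exists_hasEigenvector
  set l : ℝ := ⨅ x : { x : EuclideanSpace ℝ R // x ≠ 0 },
    RCLike.re (inner ℝ (T x) (x : EuclideanSpace ℝ R)) / ‖(x : EuclideanSpace ℝ R)‖ ^ 2 with hl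
  have hMx : M *ᵥ x.ofLp = l • x.ofLp := congrArg WithLp.ofLp hx.apply_eq_smul
  have hx0 : x.ofLp ≠ 0 := fun h => hx.2 (by ext r; exact congrFun h r)
  -- A real infimum is a lower bound only for a set bounded below; the operator norm supplies the
  -- bound.
  have hbdd : BddBelow (Set.range fun x : { x : EuclideanSpace ℝ R // x ≠ 0 } =>
      RCLike.re (inner ℝ (T x) (x : EuclideanSpace ℝ R)) /
        ‖(x : EuclideanSpace ℝ R)‖ ^ 2) := by
    refine ⟨-‖LinearMap.toContinuousLinearMap T‖, ?_⟩
    rintro _ ⟨y, rfl⟩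
    have hy : 0 < ‖(y : EuclideanSpace ℝ R)‖ := norm_pos_iff.2 y.2
    simp only
    rw [le_div_iff₀ (by positivity), neg_mul, neg_le]
    have h1 := abs_real_inner_le_norm (T y) (y : EuclideanSpace ℝ R)
    have h2 := (LinearMap.toContinuousLinearMap T).le_opNorm (y : EuclideanSpace ℝ R)
    have h3 := neg_abs_le (inner ℝ (T y) (y : EuclideanSpace ℝ R))
    simp only [RCLike.re_to_real, LinearMap.coe_toContinuousLinearMap'] at *
    nlinarith
  have hle : ∀ t : R → ℝ, l * ∑ r, t r ^ 2 ≤ Q t := by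
    intro t
    by_cases ht : t = 0
    · subst ht; simp
    · have hne : (WithLp.toLp 2 t : EuclideanSpace ℝ R) ≠ 0 := fun h =>
        ht (congrArg WithLp.ofLp h)
      have h1 := ciInf_le hbdd ⟨_, hne⟩
      rw [← hl] at h1
      simp only [RCLike.re_to_real, hTQ] at h1
      have hpos : 0 < ‖(WithLp.toLp 2 t : EuclideanSpace ℝ R)‖ := norm_pos_iff.2 hne
      rw [le_div_iff₀ (by positivity), hnorm] at h1
      exact h1
  refine ⟨l, ⟨?_, ?_⟩, ⟨x.ofLp, hx0, heig l _ hMx⟩, hle⟩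
  · refine Module.End.hasEigenvalue_of_hasEigenvector (x := x.ofLp) ⟨?_, hx0⟩
    rw [Module.End.mem_eigenspace_iff, Matrix.toLin'_apply]
    exact hMx
  · intro μ hμ
    obtain ⟨y, hy⟩ := Module.End.HasEigenvalue.exists_hasEigenvector hμ
    have h1 := hy.apply_eq_smul
    rw [Matrix.toLin'_apply] at h1
    have h2 := hle y
    rw [heig μ y h1] at h2
    refine le_of_mul_le_mul_right h2 ?_
    obtain ⟨r, hr⟩ := Function.ne_iff.1 hy.2
    exact Finset.sum_pos' (fun r _ => sq_nonneg _)
      ⟨r, Finset.mem_univ _, by simpa using pow_pos (abs_pos.2 hr) 2⟩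

end Eigenvalue

/-! ### Orthogonality of functions of different coordinates. -/

section PiSums

variable {I : Type*} [Fintype I] [DecidableEq I] {α : I → Type*} [∀ i, Fintype (α i)]

/-- Expand a product of sums in which every factor except the i-th is the constant 1. Multiplying by
the i-th cardinality avoids division. -/
theorem sum_pi_comp_eval (i : I) (f : α i → ℝ) :
    Fintype.card (α i) * ∑ J : (i : I) → α i, f (J i) =
      (∏ i, (Fintype.card (α i) : ℝ)) * ∑ j, f j := by
  have h := Finset.prod_univ_sum (fun i => (Finset.univ : Finset (α i)))
    (Function.update (fun _ _ => (1 : ℝ)) i f)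
  rw [Fintype.piFinset_univ] at h
  have h1 : ∀ J : (i : I) → α i,
      ∏ i', Function.update (fun _ _ => (1 : ℝ)) i f i' (J i') = f (J i) := by
    intro J
    rw [Finset.prod_eq_single i (fun i' _ hi' => by rw [Function.update_of_ne hi'])
      (fun hi => absurd (Finset.mem_univ i) hi), Function.update_self]
  simp_rw [h1] at h
  rw [← h, ← Finset.mul_prod_erase Finset.univ _ (Finset.mem_univ i),
    ← Finset.mul_prod_erase Finset.univ (fun i => (Fintype.card (α i) : ℝ)) (Finset.mem_univ i),
    Function.update_self]
  have h2 : ∏ i' ∈ Finset.univ.erase i, ∑ j, Function.update (fun _ _ => (1 : ℝ)) i f i' j =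
      ∏ i' ∈ Finset.univ.erase i, (Fintype.card (α i') : ℝ) := by
    refine Finset.prod_congr rfl fun i' hi' => ?_
    rw [Function.update_of_ne (Finset.ne_of_mem_erase hi')]
    simp
  rw [h2]
  ring

theorem sum_pi_mul_eq_zero {i i' : I} (hne : i ≠ i') (f : α i → ℝ) (f' : α i' → ℝ)
    (hf : ∑ j, f j = 0) : ∑ J : (i : I) → α i, f (J i) * f' (J i') = 0 := by
  have h := Finset.prod_univ_sum (fun i => (Finset.univ : Finset (α i)))
    (Function.update (Function.update (fun _ _ => (1 : ℝ)) i f) i' f')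
  rw [Fintype.piFinset_univ] at h
  have h1 : ∀ J : (i : I) → α i, ∏ i'', Function.update (Function.update
      (fun _ _ => (1 : ℝ)) i f) i' f' i'' (J i'') = f (J i) * f' (J i') := by
    intro J
    rw [Finset.prod_eq_mul i i' hne (fun c _ hc => by
      rw [Function.update_of_ne hc.2, Function.update_of_ne hc.1])
      (fun hi => absurd (Finset.mem_univ i) hi) (fun hi => absurd (Finset.mem_univ i') hi),
      Function.update_self, Function.update_of_ne hne, Function.update_self]
  simp_rw [h1] at h
  rw [← h]
  refine Finset.prod_eq_zero (Finset.mem_univ i) ?_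
  rw [Function.update_of_ne hne, Function.update_self, hf]

/-- The sum of squares of a sum of independent centered functions. -/
theorem sum_pi_sq_eq [∀ i, Nonempty (α i)] (c : ℝ) (g : (i : I) → α i → ℝ)
    (hg : ∀ i, ∑ j, g i j = 0) :
    ∑ J : (i : I) → α i, (c + ∑ i, g i (J i)) ^ 2 =
      (∏ i, (Fintype.card (α i) : ℝ)) *
        (c ^ 2 + ∑ i, (∑ j, g i j ^ 2) / Fintype.card (α i)) := by
  have hc : ∀ i, (Fintype.card (α i) : ℝ) ≠ 0 := fun i => by
    exact_mod_cast Fintype.card_ne_zero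
  have hlin : ∀ i, ∑ J : (i : I) → α i, g i (J i) = 0 := by
    intro i
    have := sum_pi_comp_eval i (g i)
    rw [hg, mul_zero] at this
    exact (mul_eq_zero.1 this).resolve_left (hc i)
  have hsq : ∀ i, ∑ J : (i : I) → α i, g i (J i) ^ 2 =
      (∏ i, (Fintype.card (α i) : ℝ)) * ((∑ j, g i j ^ 2) / Fintype.card (α i)) := by
    intro i
    have := sum_pi_comp_eval i (fun j => g i j ^ 2)
    have h := hc i
    field_simp
    linarith
  have hexp : ∀ J : (i : I) → α i, (c + ∑ i, g i (J i)) ^ 2 =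
      c ^ 2 + 2 * c * ∑ i, g i (J i) + ∑ i, ∑ i', g i (J i) * g i' (J i') := by
    intro J
    rw [add_sq, sq (∑ i, g i (J i)), Finset.sum_mul_sum]
  simp_rw [hexp]
  rw [Finset.sum_add_distrib, Finset.sum_add_distrib, ← Finset.mul_sum, Finset.sum_comm,
    Finset.sum_congr rfl fun i _ => hlin i, Finset.sum_const_zero, mul_zero, add_zero, mul_add,
    Finset.mul_sum, Finset.sum_comm]
  congr 1
  · simp [Fintype.card_pi]
  · refine Finset.sum_congr rfl fun i _ => ?_
    rw [← hsq, Finset.sum_comm, Finset.sum_eq_single i]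
    · simp only [sq]
    · intro i' _ hi'
      exact sum_pi_mul_eq_zero hi'.symm _ _ (hg i)
    · intro hi
      exact absurd (Finset.mem_univ i) hi

end PiSums

/-! ### The linear forms of the section matrix. -/

section Transport

variable {ν : ℕ} {k : Fin ν → ℕ}

/-- The coordinates of `t` in direction `i`, extended by zero to the last index. -/
def extendZero (t : Eqn k → ℝ) (i : Fin ν) (j : Fin (k i)) : ℝ :=
  if h : (j : ℕ) + 1 < k i then t (some ⟨i, ⟨j, h⟩⟩) else 0

theorem sum_subtype_eq_sum_extendZero (t : Eqn k → ℝ) (i : Fin ν) (f : Fin (k i) → ℝ → ℝ)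
    (hf : ∀ j, f j 0 = 0) :
    ∑ j : {j : Fin (k i) // (j : ℕ) + 1 < k i}, f j.1 (t (some ⟨i, j⟩)) =
      ∑ j, f j (extendZero t i j) := by
  have h1 : ∀ j : {j : Fin (k i) // (j : ℕ) + 1 < k i}, f j.1 (t (some ⟨i, j⟩)) =
      f j.1 (extendZero t i j.1) := by
    intro j
    rw [extendZero, dif_pos j.2]
  simp_rw [h1]
  rw [← Finset.sum_subtype (Finset.univ.filter fun j : Fin (k i) => (j : ℕ) + 1 < k i)
    (by simp) fun j => f j (extendZero t i j), Finset.sum_filter]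
  refine Finset.sum_congr rfl fun j _ => ?_
  by_cases h : (j : ℕ) + 1 < k i
  · rw [if_pos h]
  · rw [if_neg h, extendZero, dif_neg h, hf]

theorem sum_sectionMatrix_mul (t : Eqn k → ℝ) (J : Cell k) :
    ∑ r, sectionMatrix k r J * t r = t none + ∑ i, extendZero t i (J i) := by
  rw [Fintype.sum_option, Fintype.sum_sigma]
  congr 1
  · simp [sectionMatrix]
  · refine Finset.sum_congr rfl fun i _ => ?_
    have := sum_subtype_eq_sum_extendZero t i (fun j x => (if J i = j then 1 else 0) * x) (by simp)
    simpa [sectionMatrix] using this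

theorem sum_sq_eq_extendZero (t : Eqn k → ℝ) :
    ∑ r, t r ^ 2 = t none ^ 2 + ∑ i, ∑ j, extendZero t i j ^ 2 := by
  rw [Fintype.sum_option, Fintype.sum_sigma]
  congr 1
  exact Finset.sum_congr rfl fun i _ =>
    sum_subtype_eq_sum_extendZero t i (fun _ x => x ^ 2) (by simp)

/-- The values of the linear forms, decomposed into a constant and centered terms. -/
theorem exists_centered_decomposition (hk : ∀ i, 1 < k i) (t : Eqn k → ℝ) :
    ∃ (c : ℝ) (g : (i : Fin ν) → Fin (k i) → ℝ), (∀ i, ∑ j, g i j = 0) ∧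
      (∀ J : Cell k, ∑ r, sectionMatrix k r J * t r = c + ∑ i, g i (J i)) ∧
      ∑ r, t r ^ 2 ≤ (ν + 1) * c ^ 2 + ∑ i, ((ν : ℝ) + 2 + k i) * ∑ j, g i j ^ 2 := by
  set m : Fin ν → ℝ := fun i => (∑ j, extendZero t i j) / k i with hm
  have hk0 : ∀ i, (k i : ℝ) ≠ 0 := fun i => by
    have := hk i
    positivity
  have hg : ∀ i, ∑ j, (extendZero t i j - m i) = 0 := by
    intro i
    rw [Finset.sum_sub_distrib, Finset.sum_const, Finset.card_univ, Fintype.card_fin, nsmul_eq_mul,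
      hm]
    have := hk0 i
    field_simp
    ring
  refine ⟨t none + ∑ i, m i, fun i j => extendZero t i j - m i, hg, fun J => ?_, ?_⟩
  · rw [sum_sectionMatrix_mul, Finset.sum_sub_distrib]
    ring
  -- The omitted last equation makes the extended coordinate zero there, so the centered value at
  -- the last index is -m_i.
  · have hlast : ∀ i, m i ^ 2 ≤ ∑ j, (extendZero t i j - m i) ^ 2 := by
      intro i
      have hki := hk i
      let j₀ : Fin (k i) := ⟨k i - 1, by omega⟩
      have h0 : extendZero t i j₀ = 0 := by
        rw [extendZero, dif_neg]
        simp only [j₀]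
        omega
      have := Finset.single_le_sum (f := fun j => (extendZero t i j - m i) ^ 2)
        (fun j _ => sq_nonneg _) (Finset.mem_univ j₀)
      simp only [h0, zero_sub, neg_sq] at this
      exact this
    have hsq : ∀ i, ∑ j, extendZero t i j ^ 2 =
        ∑ j, (extendZero t i j - m i) ^ 2 + k i * m i ^ 2 := by
      intro i
      have e : ∀ j, extendZero t i j ^ 2 = (extendZero t i j - m i) ^ 2 +
          2 * m i * (extendZero t i j - m i) + m i ^ 2 := fun j => by ring
      simp_rw [e]
      rw [Finset.sum_add_distrib, Finset.sum_add_distrib, ← Finset.mul_sum, hg, Finset.sum_const,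
        Finset.card_univ, Fintype.card_fin, nsmul_eq_mul]
      ring
    -- With x = t none + ∑ m_i and y = ∑ m_i: (x - y)² ≤ (ν + 1)x² + (ν + 1)y²/ν, then y² ≤ ν ∑
    -- m_i². The case ν = 0 is separate because of the division.
    have hnone : t none ^ 2 ≤
        (ν + 1) * (t none + ∑ i, m i) ^ 2 + (ν + 1) * ∑ i, m i ^ 2 := by
      have h1 : (∑ i, m i) ^ 2 ≤ ν * ∑ i, m i ^ 2 := by
        simpa using sq_sum_le_card_mul_sum_sq (s := Finset.univ) (f := m)
      have hν : (0 : ℝ) ≤ ν := Nat.cast_nonneg _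
      have h2 : 0 ≤ ∑ i, m i ^ 2 := Finset.sum_nonneg fun i _ => sq_nonneg _
      rcases hν.eq_or_lt with h0 | h0
      · rw [← h0] at h1 ⊢
        have : ∑ i, m i = 0 := by nlinarith
        rw [this]; nlinarith
      · have h3 : t none ^ 2 ≤ (ν + 1) * (t none + ∑ i, m i) ^ 2 +
            (ν + 1) * ((∑ i, m i) ^ 2 / ν) := by
          have h4 : (ν + 1) * (t none + ∑ i, m i) ^ 2 + (ν + 1) * ((∑ i, m i) ^ 2 / ν) - t none ^ 2
              = (ν * (t none + ∑ i, m i) + ∑ i, m i) ^ 2 / ν := by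
            field_simp
            ring
          have h5 : 0 ≤ (ν * (t none + ∑ i, m i) + ∑ i, m i) ^ 2 / (ν : ℝ) := by positivity
          linarith
        refine h3.trans ?_
        gcongr
        rw [div_le_iff₀ h0]
        linarith
    rw [sum_sq_eq_extendZero]
    have hsum : ∑ i, ∑ j, extendZero t i j ^ 2 + (ν + 1) * ∑ i, m i ^ 2 ≤
        ∑ i, ((ν : ℝ) + 2 + k i) * ∑ j, (extendZero t i j - m i) ^ 2 := by
      rw [Finset.mul_sum, ← Finset.sum_add_distrib]
      refine Finset.sum_le_sum fun i _ => ?_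
      rw [hsq]
      have h1 := hlast i
      have h2 : (0 : ℝ) ≤ k i := Nat.cast_nonneg _
      have h3 : (0 : ℝ) ≤ ν := Nat.cast_nonneg _
      nlinarith
    linarith

theorem sum_sq_section_eq {c : ℝ} {g : (i : Fin ν) → Fin (k i) → ℝ} (hk : ∀ i, 1 < k i)
    (hg : ∀ i, ∑ j, g i j = 0) :
    ∑ J : Cell k, (c + ∑ i, g i (J i)) ^ 2 =
      (∏ i, (k i : ℝ)) * (c ^ 2 + ∑ i, (∑ j, g i j ^ 2) / k i) := by
  have : ∀ i, Nonempty (Fin (k i)) := fun i => ⟨⟨0, by have := hk i; omega⟩⟩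
  simpa using sum_pi_sq_eq c g hg

/-- One cell sees a single value of each g_i, so its square is at most ∑_j g_i(j)², which the full
sum carries with weight 1/k_i; the loss is k_i ≤ M. This produces κ. -/
theorem sq_section_le (hk : ∀ i, 1 < k i) {M : ℝ} (hM1 : 1 ≤ M) (hM : ∀ i, (k i : ℝ) ≤ M)
    (t : Eqn k → ℝ) (J : Cell k) :
    (∏ i, (k i : ℝ)) * (∑ r, sectionMatrix k r J * t r) ^ 2 ≤
      (ν + 1) * M * ∑ J : Cell k, (∑ r, sectionMatrix k r J * t r) ^ 2 := by
  obtain ⟨c, g, hg, hU, -⟩ := exists_centered_decomposition hk t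
  simp_rw [hU]
  rw [sum_sq_section_eq hk hg]
  have hK : 0 ≤ ∏ i, (k i : ℝ) := Finset.prod_nonneg fun i _ => Nat.cast_nonneg _
  have h1 : (c + ∑ i, g i (J i)) ^ 2 ≤ (ν + 1) * (c ^ 2 + ∑ i, g i (J i) ^ 2) := by
    have := sq_sum_le_card_mul_sum_sq (s := Finset.univ)
      (f := fun o : Option (Fin ν) => o.elim c fun i => g i (J i))
    rw [Fintype.sum_option, Fintype.sum_option] at this
    simpa using this
  have h2 : c ^ 2 + ∑ i, g i (J i) ^ 2 ≤ M * (c ^ 2 + ∑ i, (∑ j, g i j ^ 2) / k i) := by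
    rw [mul_add, Finset.mul_sum]
    refine add_le_add (by nlinarith [sq_nonneg c]) (Finset.sum_le_sum fun i _ => ?_)
    have hki : (0 : ℝ) < k i := by have := hk i; positivity
    have h3 : g i (J i) ^ 2 ≤ ∑ j, g i j ^ 2 :=
      Finset.single_le_sum (f := fun j => g i j ^ 2) (fun j _ => sq_nonneg _) (Finset.mem_univ _)
    have h4 : 0 ≤ ∑ j, g i j ^ 2 := Finset.sum_nonneg fun j _ => sq_nonneg _
    rw [← mul_div_assoc, le_div_iff₀ hki]
    nlinarith [hM i]
  calc _ ≤ (∏ i, (k i : ℝ)) *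
        ((ν + 1) * (M * (c ^ 2 + ∑ i, (∑ j, g i j ^ 2) / k i))) := by
        gcongr
        exact h1.trans (by gcongr)
    _ = _ := by ring

/-- The norm of t weights ∑_j g_i(j)² by about k_i and the normalized form weights it by 1/k_i; the
ratio k_i² is the M² here and the loss n² in the eigenvalue. -/
theorem sum_sq_le_sum_sq_section (hk : ∀ i, 1 < k i) {M : ℝ} (hM1 : 1 ≤ M)
    (hM : ∀ i, (k i : ℝ) ≤ M) (t : Eqn k → ℝ) :
    (∏ i, (k i : ℝ)) * ∑ r, t r ^ 2 ≤
      (ν + 3) * M ^ 2 * ∑ J : Cell k, (∑ r, sectionMatrix k r J * t r) ^ 2 := by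
  obtain ⟨c, g, hg, hU, hle⟩ := exists_centered_decomposition hk t
  simp_rw [hU]
  rw [sum_sq_section_eq hk hg]
  have hK : 0 ≤ ∏ i, (k i : ℝ) := Finset.prod_nonneg fun i _ => Nat.cast_nonneg _
  have hν : (0 : ℝ) ≤ ν := Nat.cast_nonneg _
  have hM2 : 1 ≤ M ^ 2 := one_le_pow₀ hM1
  have h2 : (ν + 1) * c ^ 2 + ∑ i, ((ν : ℝ) + 2 + k i) * ∑ j, g i j ^ 2 ≤
      (ν + 3) * M ^ 2 * (c ^ 2 + ∑ i, (∑ j, g i j ^ 2) / k i) := by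
    rw [mul_add, Finset.mul_sum]
    refine add_le_add ?_ (Finset.sum_le_sum fun i _ => ?_)
    · gcongr
      nlinarith
    have hki : (1 : ℝ) ≤ k i := by exact_mod_cast (hk i).le
    have h4 : 0 ≤ ∑ j, g i j ^ 2 := Finset.sum_nonneg fun j _ => sq_nonneg _
    rw [← mul_div_assoc, le_div_iff₀ (by linarith), mul_right_comm]
    refine mul_le_mul_of_nonneg_right ?_ h4
    have h5 : (k i : ℝ) ^ 2 ≤ M ^ 2 := by gcongr; exact hM i
    calc ((ν : ℝ) + 2 + k i) * k i ≤ ((ν + 3) * k i) * k i := by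
          gcongr; nlinarith
      _ = (ν + 3) * (k i : ℝ) ^ 2 := by ring
      _ ≤ _ := by gcongr
  calc _ ≤ (∏ i, (k i : ℝ)) *
        ((ν + 3) * M ^ 2 * (c ^ 2 + ∑ i, (∑ j, g i j ^ 2) / k i)) := by
        gcongr
        exact hle.trans h2
    _ = _ := by ring

/-- The vector on which the smallest eigenvalue is essentially attained. -/
def testVector (k : Fin ν → ℕ) (i₀ : Fin ν) : Eqn k → ℝ
  | none => -1
  | some e => if e.1 = i₀ then 1 else 0

theorem extendZero_testVector (i₀ i : Fin ν) (j : Fin (k i)) :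
    extendZero (testVector k i₀) i j = if i = i₀ ∧ (j : ℕ) + 1 < k i then 1 else 0 := by
  unfold extendZero
  by_cases h : (j : ℕ) + 1 < k i
  · simp [h, testVector]
  · simp [h]

theorem sum_ite_last {n : ℕ} (hn : 1 < n) :
    ∑ j : Fin n, (if (j : ℕ) + 1 < n then (0 : ℝ) else 1) = 1 := by
  rw [Finset.sum_eq_single (⟨n - 1, by omega⟩ : Fin n)]
  · rw [if_neg]
    simp only
    omega
  · intro j _ hj
    rw [if_pos]
    have := j.2
    have h1 : (j : ℕ) ≠ n - 1 := fun h => hj (Fin.ext h)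
    omega
  · intro h
    exact absurd (Finset.mem_univ _) h

theorem sum_testVector_sq (hk : ∀ i, 1 < k i) (i₀ : Fin ν) :
    ∑ r, testVector k i₀ r ^ 2 = k i₀ := by
  rw [sum_sq_eq_extendZero, Finset.sum_eq_single i₀]
  · have h1 : ∀ j : Fin (k i₀), extendZero (testVector k i₀) i₀ j ^ 2 =
        1 - if (j : ℕ) + 1 < k i₀ then (0 : ℝ) else 1 := by
      intro j
      rw [extendZero_testVector]
      by_cases h : (j : ℕ) + 1 < k i₀ <;> simp [h]
    simp_rw [h1]
    rw [Finset.sum_sub_distrib, sum_ite_last (hk i₀)]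
    simp [testVector]
  · intro i _ hi
    simp [extendZero_testVector, hi]
  · intro h
    exact absurd (Finset.mem_univ _) h

/-- The linear form is -1 on cells whose i₀-th index is last and 0 elsewhere, so the sum counts one
slice. -/
theorem sum_section_testVector_sq (hk : ∀ i, 1 < k i) (i₀ : Fin ν) :
    k i₀ * ∑ J : Cell k, (∑ r, sectionMatrix k r J * testVector k i₀ r) ^ 2 =
      ∏ i, (k i : ℝ) := by
  have h1 : ∀ J : Cell k, (∑ r, sectionMatrix k r J * testVector k i₀ r) ^ 2 =
      if (J i₀ : ℕ) + 1 < k i₀ then (0 : ℝ) else 1 := by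
    intro J
    rw [sum_sectionMatrix_mul, Finset.sum_eq_single i₀]
    · rw [extendZero_testVector]
      by_cases h : (J i₀ : ℕ) + 1 < k i₀ <;> simp [h, testVector]
    · intro i _ hi
      simp [extendZero_testVector, hi]
    · intro h
      exact absurd (Finset.mem_univ _) h
  simp_rw [h1]
  have h2 := sum_pi_comp_eval (α := fun i => Fin (k i)) i₀
    (fun j => if (j : ℕ) + 1 < k i₀ then (0 : ℝ) else 1)
  rw [sum_ite_last (hk i₀)] at h2
  simpa using h2

end Transport

/-! ### The Gaussian integral equals the Gaussian formula. -/

section GaussianFormula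

variable {R ι : Type*} [Fintype R] [DecidableEq R] [Fintype ι] {A : Matrix R ι ℝ}
  {z : EuclideanSpace ℝ ι}

theorem halfSq_columnForm (A : Matrix R ι ℝ) (z : EuclideanSpace ℝ ι) (ξ : EuclideanSpace ℝ R) :
    halfSq (columnForm A z) ξ =
      1 / 2 * ‖Matrix.toEuclideanLin ((2 * Real.pi) • (scaledMatrix A z)ᵀ) ξ‖ ^ 2 := by
  rw [halfSq, EuclideanSpace.norm_sq_eq]
  congr 1
  refine Finset.sum_congr rfl fun j _ => ?_
  rw [Real.norm_eq_abs, sq_abs]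
  congr 1
  rw [columnForm_apply, Matrix.toLpLin_apply]
  change _ = ∑ r, (2 * Real.pi * (z j * A r j)) * ξ r
  rw [Finset.mul_sum]
  exact Finset.sum_congr rfl fun r _ => by ring

theorem det_mul_transpose_pos_of_halfSq_pos
    (hpos : ∀ ξ, ξ ≠ 0 → 0 < halfSq (columnForm A z) ξ) : 0 < (A * Aᵀ).det := by
  have hinj : Function.Injective (Matrix.toEuclideanLin Aᵀ) := by
    rw [injective_iff_map_eq_zero]
    intro ξ hξ
    by_contra hne
    have h1 := hpos ξ hne
    have h2 : ∀ j, ∑ r, A r j * ξ r = 0 := fun j => congrFun (congrArg WithLp.ofLp hξ) j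
    simp [halfSq, columnForm_apply, h2] at h1
  have h := normDet_toEuclideanLin_sq Aᵀ
  rw [Matrix.transpose_transpose] at h
  rw [← h]
  exact pow_pos (normDet_pos_of_injective hinj) 2

/-- The Fourier factor 2π in each form scales the determinant by (2π)^d; against the (2π)^{d/2} of
the Gaussian integral this leaves (2π)^{-d/2}. -/
theorem integral_exp_neg_halfSq_columnForm
    (hpos : ∀ ξ, ξ ≠ 0 → 0 < halfSq (columnForm A z) ξ) :
    Integrable (fun ξ => Real.exp (-halfSq (columnForm A z) ξ)) ∧
    gaussianFormula A z = Real.exp (entropy z) * Real.sqrt (A * Aᵀ).det *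
      ∫ ξ, Real.exp (-halfSq (columnForm A z) ξ) := by
  set B := scaledMatrix A z with hB
  set W : Matrix ι R ℝ := (2 * Real.pi) • Bᵀ with hW
  have hinj : Function.Injective (Matrix.toEuclideanLin W) := by
    rw [injective_iff_map_eq_zero]
    intro ξ hξ
    by_contra hne
    have h1 := hpos ξ hne
    rw [halfSq_columnForm, ← hB, ← hW, hξ] at h1
    simp at h1
  obtain ⟨h1, h2⟩ := integral_exp_neg_half_sq_norm hinj
  simp_rw [halfSq_columnForm, ← hB, ← hW]
  refine ⟨h1, ?_⟩
  rw [h2, finrank_euclideanSpace]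
  have hnd : (Matrix.toEuclideanLin W).normDet =
      (2 * Real.pi) ^ (Fintype.card R) * Real.sqrt (B * Bᵀ).det := by
    have h3 := normDet_toEuclideanLin_sq W
    have h4 : Wᵀ * W = (2 * Real.pi) ^ 2 • (B * Bᵀ) := by
      rw [hW, Matrix.transpose_smul, Matrix.transpose_transpose, Matrix.smul_mul, Matrix.mul_smul,
        smul_smul, sq]
    rw [h4, Matrix.det_smul, pow_right_comm] at h3
    rw [← Real.sqrt_sq (LinearMap.normDet_nonneg (Matrix.toEuclideanLin W)), h3,
      Real.sqrt_mul (by positivity), Real.sqrt_sq (by positivity)]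
  have hpi : 0 < 2 * Real.pi := by positivity
  have hsplit : (2 * Real.pi) ^ (Fintype.card R) =
      (2 * Real.pi) ^ ((Fintype.card R : ℝ) / 2) * (2 * Real.pi) ^ ((Fintype.card R : ℝ) / 2) := by
    rw [← Real.rpow_add hpi, add_halves, Real.rpow_natCast]
  have hB0 : Real.sqrt (B * Bᵀ).det ≠ 0 := by
    intro h0
    have := normDet_pos_of_injective hinj
    rw [hnd, h0, mul_zero] at this
    exact lt_irrefl _ this
  have hp2 : 0 < (2 * Real.pi) ^ ((Fintype.card R : ℝ) / 2) := Real.rpow_pos_of_pos hpi _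
  rw [gaussianFormula, ← hB, hnd, Real.sqrt_div (det_mul_transpose_nonneg A), hsplit]
  field_simp

/-- The relative error of the Gaussian formula. -/
theorem abs_gaussianFormula_sub_vol_le {b : R → ℝ} (hcenter : IsAnalyticCenter (polyhedron A b) z)
    (hpos : ∀ ξ, ξ ≠ 0 → 0 < halfSq (columnForm A z) ξ) {κ p : ℝ} (hκ : 0 < κ)
    (hu : ∀ j ξ, columnForm A z j ξ ^ 2 ≤ κ * halfSq (columnForm A z) ξ)
    (hd : 2 ≤ Fintype.card R) (hp : p = ((Fintype.card R : ℝ) + 3) / 2) (hpκ : p * κ < 1) :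
    0 ≤ gaussianFormula A z ∧
    |gaussianFormula A z - vol (Fintype.card ι - Fintype.card R) (polyhedron A b)| ≤
      Fintype.card ι * ((1 - p * κ) ^ (-p) * (12 * Real.exp (1 / 4) * Real.sqrt κ ^ 3)) *
        gaussianFormula A z := by
  have hA := (det_mul_transpose_pos_of_halfSq_pos hpos).ne'
  obtain ⟨hint, hG⟩ := integral_exp_neg_halfSq_columnForm hpos
  have hfr : Module.finrank ℝ (EuclideanSpace ℝ R) = Fintype.card R := finrank_euclideanSpace
  have hψ : Integrable (charProd (columnForm A z)) :=
    integrable_charProd volume _ hκ hu hint (by rwa [hfr])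
      (by rw [hfr]; rw [hp] at hpκ; nlinarith)
  have herr := norm_integral_charProd_sub_le volume _ hpos hκ hu hint (by rwa [hfr])
    (by rw [hfr]; exact hp) hpκ
  have hvol := vol_polyhedron_eq_integral hA hcenter hψ
  set c : ℝ := Real.exp (entropy z) * Real.sqrt (A * Aᵀ).det with hc
  have hc0 : 0 ≤ c := by positivity
  set I : ℝ := ∫ ξ, Real.exp (-halfSq (columnForm A z) ξ) with hI
  have hI0 : 0 ≤ I := integral_nonneg fun ξ => (Real.exp_pos _).le
  refine ⟨by rw [hG]; positivity, ?_⟩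
  rw [← Complex.ofReal_mul, ← hc] at hvol
  rw [abs_sub_comm, ← Real.norm_eq_abs, ← Complex.norm_real, Complex.ofReal_sub, hvol, hG,
    Complex.ofReal_mul c I, ← mul_sub, norm_mul, Complex.norm_real,
    Real.norm_of_nonneg hc0]
  calc _ ≤ c * _ := mul_le_mul_of_nonneg_left herr hc0
    _ = _ := by ring

end GaussianFormula

/-! ### Bounds in terms of n. -/

section TransportBounds

variable {ν : ℕ} {k : Fin ν → ℕ}

theorem card_eqn (k : Fin ν → ℕ) : Fintype.card (Eqn k) = (∑ i, (k i - 1)) + 1 := by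
  rw [Fintype.card_option, Fintype.card_sigma]
  congr 1
  refine Finset.sum_congr rfl fun i _ => ?_
  let e : {j : Fin (k i) // (j : ℕ) + 1 < k i} ≃ Fin (k i - 1) :=
    { toFun := fun j => ⟨j.1, by have := j.2; omega⟩
      invFun := fun j => ⟨⟨j, by omega⟩, by simp only; omega⟩
      left_inv := fun j => rfl
      right_inv := fun j => rfl }
  rw [Fintype.card_congr e, Fintype.card_fin]

theorem card_cell (k : Fin ν → ℕ) : Fintype.card (Cell k) = ∏ i, k i := by
  simp [Fintype.card_pi]

section Bounds

variable {a b δ Δ : ℝ} {n : ℕ} {z : EuclideanSpace ℝ (Cell k)}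

theorem pos_of_size_bounds (hν : 2 ≤ ν) (hk : ∀ i, 1 < k i)
    (hb : ∀ i, (k i : ℝ) ≤ b * n) : 0 < (n : ℝ) ∧ 0 < b ∧ 1 ≤ b * n := by
  let i₀ : Fin ν := ⟨0, by omega⟩
  have h1 : (1 : ℝ) < k i₀ := by exact_mod_cast hk i₀
  have h2 : 1 ≤ b * n := by linarith [hb i₀]
  have h3 : (0 : ℝ) ≤ n := Nat.cast_nonneg n
  have hn : 0 < (n : ℝ) := by
    rcases h3.eq_or_lt with h | h
    · rw [← h] at h2; linarith
    · exact h
  exact ⟨hn, pos_of_mul_pos_left (by linarith) h3, h2⟩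

theorem pow_le_prod_size (ha : 0 < a) (hab : ∀ i, a * n ≤ k i) :
    a ^ ν * (n : ℝ) ^ ν ≤ ∏ i, (k i : ℝ) := by
  have := Finset.prod_le_prod (s := Finset.univ) (f := fun _ : Fin ν => a * n)
    (g := fun i => (k i : ℝ)) (fun i _ => by positivity) fun i _ => hab i
  simpa [mul_pow] using this

theorem prod_size_le_pow (hb : ∀ i, (k i : ℝ) ≤ b * n) :
    ∏ i, (k i : ℝ) ≤ b ^ ν * (n : ℝ) ^ ν := by
  have := Finset.prod_le_prod (s := Finset.univ) (f := fun i => (k i : ℝ))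
    (g := fun _ : Fin ν => b * n) (fun i _ => by positivity) fun i _ => hb i
  simpa [mul_pow] using this

theorem momentForm_lower (ha : 0 < a) (hδ : 0 < δ) (hν : 2 ≤ ν) (hk : ∀ i, 1 < k i)
    (hab : ∀ i, a * n ≤ k i ∧ (k i : ℝ) ≤ b * n) (hz : ∀ J, δ ≤ z J) (t : Eqn k → ℝ) :
    δ ^ 2 * a ^ ν / (2 * (ν + 3) * (b ^ 2 + 1)) * (n : ℝ) ^ (ν - 2) * ∑ r, t r ^ 2 ≤
      momentForm (sectionMatrix k) z t := by
  obtain ⟨hn, hb, hbn⟩ := pos_of_size_bounds hν hk fun i => (hab i).2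
  have hmain := sum_sq_le_sum_sq_section hk hbn (fun i => (hab i).2) t
  have hK := pow_le_prod_size ha fun i => (hab i).1
  rw [momentForm_apply]
  set T := ∑ r, t r ^ 2 with hT
  set S := ∑ J : Cell k, (∑ r, sectionMatrix k r J * t r) ^ 2 with hS
  have hT0 : 0 ≤ T := Finset.sum_nonneg fun r _ => sq_nonneg _
  have hS0 : 0 ≤ S := Finset.sum_nonneg fun r _ => sq_nonneg _
  have h1 : δ ^ 2 * S ≤ ∑ J, z J ^ 2 * (∑ r, sectionMatrix k r J * t r) ^ 2 := by
    rw [hS, Finset.mul_sum]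
    gcongr with J
    exact hz J
  have hpow : (n : ℝ) ^ ν = (n : ℝ) ^ (ν - 2) * (n : ℝ) ^ 2 := by
    rw [← pow_add, Nat.sub_add_cancel hν]
  have h2 : a ^ ν * (n : ℝ) ^ (ν - 2) * T ≤ (ν + 3) * (b ^ 2 + 1) * S := by
    have h3 : (n : ℝ) ^ 2 * (a ^ ν * (n : ℝ) ^ (ν - 2) * T) ≤
        (n : ℝ) ^ 2 * ((ν + 3) * b ^ 2 * S) := by
      calc _ = a ^ ν * (n : ℝ) ^ ν * T := by rw [hpow]; ring
        _ ≤ (∏ i, (k i : ℝ)) * T := by gcongr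
        _ ≤ _ := hmain
        _ = _ := by ring
    refine (le_of_mul_le_mul_left h3 (by positivity)).trans ?_
    gcongr
    linarith
  calc δ ^ 2 * a ^ ν / (2 * (ν + 3) * (b ^ 2 + 1)) * (n : ℝ) ^ (ν - 2) * T
      = δ ^ 2 / 2 * ((a ^ ν * (n : ℝ) ^ (ν - 2) * T) / ((ν + 3) * (b ^ 2 + 1))) := by
        field_simp
    _ ≤ δ ^ 2 / 2 * S := by
        gcongr
        rw [div_le_iff₀ (by positivity)]
        linarith
    _ ≤ _ := by linarith

theorem momentForm_testVector_le (ha : 0 < a) (hν : 2 ≤ ν) (hk : ∀ i, 1 < k i)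
    (hab : ∀ i, a * n ≤ k i ∧ (k i : ℝ) ≤ b * n)
    (hz0 : ∀ J, 0 < z J) (hz : ∀ J, z J ≤ Δ) (i₀ : Fin ν) :
    momentForm (sectionMatrix k) z (testVector k i₀) ≤
      (Δ ^ 2 * |b| ^ ν / (2 * a ^ 2) + 1) * (n : ℝ) ^ (ν - 2) *
        ∑ r, testVector k i₀ r ^ 2 := by
  obtain ⟨hn, hb, hbn⟩ := pos_of_size_bounds hν hk fun i => (hab i).2
  have hkS := sum_section_testVector_sq hk i₀
  have hK := prod_size_le_pow fun i => (hab i).2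
  rw [momentForm_apply, sum_testVector_sq hk, abs_of_pos hb]
  set S := ∑ J : Cell k, (∑ r, sectionMatrix k r J * testVector k i₀ r) ^ 2 with hS
  have hS0 : 0 ≤ S := Finset.sum_nonneg fun r _ => sq_nonneg _
  have h1 : ∑ J, z J ^ 2 * (∑ r, sectionMatrix k r J * testVector k i₀ r) ^ 2 ≤ Δ ^ 2 * S := by
    rw [hS, Finset.mul_sum]
    gcongr with J
    · exact (hz0 J).le
    · exact hz J
  have hpow : (n : ℝ) ^ ν = (n : ℝ) ^ (ν - 2) * (n : ℝ) ^ 2 := by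
    rw [← pow_add, Nat.sub_add_cancel hν]
  have hk0 : (0 : ℝ) ≤ k i₀ := Nat.cast_nonneg _
  have h2 : a ^ 2 * S ≤ b ^ ν * (n : ℝ) ^ (ν - 2) * k i₀ := by
    have h3 : (n : ℝ) ^ 2 * (a ^ 2 * S) ≤
        (n : ℝ) ^ 2 * (b ^ ν * (n : ℝ) ^ (ν - 2) * k i₀) := by
      calc _ = (a * n) ^ 2 * S := by ring
        _ ≤ (k i₀ : ℝ) ^ 2 * S := by gcongr; exact (hab i₀).1
        _ = (k i₀ * S) * k i₀ := by ring
        _ ≤ (b ^ ν * (n : ℝ) ^ ν) * k i₀ := by rw [hkS]; gcongr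
        _ = _ := by rw [hpow]; ring
    exact le_of_mul_le_mul_left h3 (by positivity)
  have h4 : S ≤ b ^ ν * (n : ℝ) ^ (ν - 2) * k i₀ / a ^ 2 := by
    rw [le_div_iff₀ (by positivity)]; linarith
  calc _ ≤ 1 / 2 * (Δ ^ 2 * S) := by gcongr
    _ ≤ 1 / 2 * (Δ ^ 2 * (b ^ ν * (n : ℝ) ^ (ν - 2) * k i₀ / a ^ 2)) := by gcongr
    _ = Δ ^ 2 * b ^ ν / (2 * a ^ 2) * (n : ℝ) ^ (ν - 2) * k i₀ := by field_simp
    _ ≤ _ := by gcongr; linarith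

theorem halfSq_section_ge (hδ : 0 < δ) (hz : ∀ J, δ ≤ z J) (ξ : EuclideanSpace ℝ (Eqn k)) :
    2 * Real.pi ^ 2 * δ ^ 2 * ∑ J : Cell k, (∑ r, sectionMatrix k r J * ξ r) ^ 2 ≤
      halfSq (columnForm (sectionMatrix k) z) ξ := by
  rw [halfSq, Finset.mul_sum, Finset.mul_sum]
  refine Finset.sum_le_sum fun J _ => ?_
  rw [columnForm_apply]
  have : δ ^ 2 ≤ z J ^ 2 := by gcongr; exact hz J
  calc 2 * Real.pi ^ 2 * δ ^ 2 * (∑ r, sectionMatrix k r J * ξ r) ^ 2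
      ≤ 2 * Real.pi ^ 2 * z J ^ 2 * (∑ r, sectionMatrix k r J * ξ r) ^ 2 := by gcongr
    _ = _ := by ring

theorem halfSq_section_pos (hδ : 0 < δ) (hν : 2 ≤ ν) (hk : ∀ i, 1 < k i)
    (hb : ∀ i, (k i : ℝ) ≤ b * n) (hz : ∀ J, δ ≤ z J) (ξ : EuclideanSpace ℝ (Eqn k))
    (hξ : ξ ≠ 0) : 0 < halfSq (columnForm (sectionMatrix k) z) ξ := by
  obtain ⟨hn, hb0, hbn⟩ := pos_of_size_bounds hν hk hb
  refine lt_of_lt_of_le ?_ (halfSq_section_ge hδ hz ξ)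
  have hmain := sum_sq_le_sum_sq_section hk hbn hb ξ.ofLp
  have hK : 0 < ∏ i, (k i : ℝ) := Finset.prod_pos fun i _ => by have := hk i; positivity
  have hT : 0 < ∑ r, ξ r ^ 2 := by
    have h1 : 0 < ‖ξ‖ ^ 2 := by have := norm_pos_iff.2 hξ; positivity
    rw [EuclideanSpace.norm_sq_eq] at h1
    simpa using h1
  have h2 : 0 < (ν + 3) * (b * n) ^ 2 *
      ∑ J : Cell k, (∑ r, sectionMatrix k r J * ξ r) ^ 2 :=
    lt_of_lt_of_le (mul_pos hK hT) hmain
  have h3 := pos_of_mul_pos_right h2 (by positivity)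
  positivity

/-- This is the value of κ, of order n^{1-ν}: `sq_section_le` loses n against the n^ν cells. -/
theorem columnForm_section_sq_le (ha : 0 < a) (hδ : 0 < δ) (hν : 2 ≤ ν) (hk : ∀ i, 1 < k i)
    (hab : ∀ i, a * n ≤ k i ∧ (k i : ℝ) ≤ b * n) (hz : ∀ J, δ ≤ z J ∧ z J ≤ Δ) (J : Cell k)
    (ξ : EuclideanSpace ℝ (Eqn k)) :
    columnForm (sectionMatrix k) z J ξ ^ 2 ≤
      2 * Δ ^ 2 * (ν + 1) * b / (δ ^ 2 * a ^ ν) * (n / (n : ℝ) ^ ν) *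
        halfSq (columnForm (sectionMatrix k) z) ξ := by
  obtain ⟨hn, hb, hbn⟩ := pos_of_size_bounds hν hk fun i => (hab i).2
  have hmain := sq_section_le hk hbn (fun i => (hab i).2) ξ.ofLp J
  have hK := pow_le_prod_size ha fun i => (hab i).1
  have hge := halfSq_section_ge hδ (fun J => (hz J).1) ξ
  set S := ∑ J : Cell k, (∑ r, sectionMatrix k r J * ξ r) ^ 2 with hS
  set U := ∑ r, sectionMatrix k r J * ξ r with hU
  have h1 : U ^ 2 ≤ (ν + 1) * (b * n) * S / (a ^ ν * (n : ℝ) ^ ν) := by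
    rw [le_div_iff₀ (by positivity), mul_comm]
    exact (mul_le_mul_of_nonneg_right hK (sq_nonneg _)).trans hmain
  have hzJ : z J ^ 2 ≤ Δ ^ 2 := by
    have h := hz J
    gcongr
    · linarith
    · exact h.2
  rw [columnForm_apply, ← hU]
  calc (2 * Real.pi * z J * U) ^ 2 = 4 * Real.pi ^ 2 * z J ^ 2 * U ^ 2 := by ring
    _ ≤ 4 * Real.pi ^ 2 * Δ ^ 2 * ((ν + 1) * (b * n) * S / (a ^ ν * (n : ℝ) ^ ν)) := by gcongr
    _ = 2 * Δ ^ 2 * (ν + 1) * b / (δ ^ 2 * a ^ ν) * (n / (n : ℝ) ^ ν) *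
        (2 * Real.pi ^ 2 * δ ^ 2 * S) := by field_simp; ring
    _ ≤ _ := by gcongr

end Bounds

end TransportBounds

/-! ### Eigenvalue bounds and uniform error. -/

section Main

variable {ν : ℕ}

theorem exists_smallest_eigenvalue_bounds (hν : 2 ≤ ν) {a b δ Δ : ℝ} (ha : 0 < a) (hδ : 0 < δ)
    {n : ℕ} {k : Fin ν → ℕ} {z : EuclideanSpace ℝ (Cell k)} (hk : ∀ i, 1 < k i)
    (hab : ∀ i, a * n ≤ k i ∧ (k i : ℝ) ≤ b * n) (hz : ∀ J, δ ≤ z J ∧ z J ≤ Δ) :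
    ∃ l : ℝ, IsSmallestEigenvalue (momentForm (sectionMatrix k) z) l ∧
      δ ^ 2 * a ^ ν / (2 * (ν + 3) * (b ^ 2 + 1)) * (n : ℝ) ^ (ν - 2) ≤ l ∧
      l ≤ (Δ ^ 2 * |b| ^ ν / (2 * a ^ 2) + 1) * (n : ℝ) ^ (ν - 2) := by
  obtain ⟨l, hl, ⟨t, ht0, ht⟩, hle⟩ := exists_isSmallestEigenvalue (momentForm (sectionMatrix k) z)
  refine ⟨l, hl, ?_, ?_⟩
  · have h1 := momentForm_lower ha hδ hν hk hab (fun J => (hz J).1) t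
    rw [ht] at h1
    refine le_of_mul_le_mul_right h1 ?_
    obtain ⟨r, hr⟩ := Function.ne_iff.1 ht0
    exact Finset.sum_pos' (fun r _ => sq_nonneg _)
      ⟨r, Finset.mem_univ _, by simpa using pow_pos (abs_pos.2 hr) 2⟩
  · let i₀ : Fin ν := ⟨0, by omega⟩
    have h1 := (hle (testVector k i₀)).trans (momentForm_testVector_le ha hν hk hab
      (fun J => hδ.trans_le (hz J).1) (fun J => (hz J).2) i₀)
    refine le_of_mul_le_mul_right h1 ?_
    rw [sum_testVector_sq hk]
    have := hk i₀
    positivity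

theorem one_sub_rpow_neg_le_two {p x : ℝ} (hp : 1 ≤ p) (hx : 0 ≤ x) (hpx : p * x ≤ 1 / 2) :
    (1 - x) ^ (-p) ≤ 2 := by
  have hx1 : x ≤ 1 / 2 := by nlinarith
  have h := one_add_mul_self_le_rpow_one_add (s := -x) (by linarith) hp
  rw [Real.rpow_neg (by linarith), inv_le_comm₀ (Real.rpow_pos_of_pos (by linarith) _) two_pos]
  rw [← sub_eq_add_neg] at h
  linarith

/-- The relative error of the Gaussian formula tends to zero, uniformly. -/
theorem exists_gaussianFormula_error_le (hν : 5 ≤ ν) {a b δ Δ : ℝ} (ha : 0 < a) (hδ : 0 < δ)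
    {ε : ℝ} (hε : 0 < ε) : ∃ n₀ : ℕ,
      ∀ (n : ℕ) (k : Fin ν → ℕ) (N : ℝ) (β : (i : Fin ν) → Fin (k i) → ℝ)
        (z : EuclideanSpace ℝ (Cell k)), n₀ ≤ n → (∀ i, 1 < k i) →
        (∀ i, a * n ≤ k i ∧ (k i : ℝ) ≤ b * n) →
        IsAnalyticCenter (transportPolytope k N β) z → (∀ J, δ ≤ z J ∧ z J ≤ Δ) →
        |gaussianFormula (sectionMatrix k) z -
          vol ((∏ i, k i) - ((∑ i, (k i - 1)) + 1)) (transportPolytope k N β)| ≤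
        ε * vol ((∏ i, k i) - ((∑ i, (k i - 1)) + 1)) (transportPolytope k N β) := by
  set D : ℝ := 2 * Δ ^ 2 * (ν + 1) * b / (δ ^ 2 * a ^ ν) with hD
  set P : ℝ := (ν * b + 4) / 2 with hP
  set E : ℝ := b ^ ν * (2 * (12 * Real.exp (1 / 4))) * Real.sqrt (D ^ 3) with hE
  -- The error is first bounded relative to the formula G. From |G - v| ≤ ηG follows G ≤ (1 + ε)v,
  -- and η(1 + ε) = ε.
  set η : ℝ := ε / (1 + ε) with hη
  have hη0 : 0 < η := by positivity
  -- The first threshold gives p²κ ≤ 1/2, hence (1 - pκ)^{-p} ≤ 2; the second gives E/n ≤ η.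
  obtain ⟨n₁, hn₁⟩ := exists_nat_ge (2 * (P ^ 2 * D))
  obtain ⟨n₂, hn₂⟩ := exists_nat_ge (E / η)
  refine ⟨max n₁ n₂, fun n k N β z hn hk hab hcenter hz => ?_⟩
  have hν2 : 2 ≤ ν := by omega
  obtain ⟨hn0, hb, hbn⟩ := pos_of_size_bounds hν2 hk fun i => (hab i).2
  have hn1 : (1 : ℝ) ≤ n := by exact_mod_cast (show 1 ≤ n by exact_mod_cast hn0)
  have hΔ : 0 < Δ := by
    let J : Cell k := fun i => ⟨0, by have := hk i; omega⟩
    linarith [(hz J).1, (hz J).2]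
  have hD0 : 0 < D := by positivity
  have hnn₁ : 2 * (P ^ 2 * D) ≤ n :=
    hn₁.trans (by exact_mod_cast (le_max_left _ _).trans hn)
  have hnn₂ : E / η ≤ n := hn₂.trans (by exact_mod_cast (le_max_right _ _).trans hn)
  set κ : ℝ := D * (n / (n : ℝ) ^ ν) with hκ
  have hκ0 : 0 < κ := by positivity
  have hpow : (n : ℝ) ^ 5 ≤ (n : ℝ) ^ ν := pow_le_pow_right₀ hn1 hν
  have hcard := card_eqn k
  set p : ℝ := ((Fintype.card (Eqn k) : ℝ) + 3) / 2 with hp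
  have hcardle : (Fintype.card (Eqn k) : ℝ) ≤ ν * b * n + 1 := by
    rw [hcard]
    push_cast
    gcongr
    calc ∑ i, ((k i - 1 : ℕ) : ℝ) ≤ ∑ _i : Fin ν, b * n := by
          refine Finset.sum_le_sum fun i _ => le_trans ?_ (hab i).2
          exact_mod_cast Nat.sub_le _ _
      _ = ν * b * n := by simp; ring
  have hcard2 : 2 ≤ Fintype.card (Eqn k) := by
    rw [hcard]
    have : 1 ≤ ∑ i, (k i - 1) := by
      let i₀ : Fin ν := ⟨0, by omega⟩
      have h1 := Finset.single_le_sum (f := fun i => k i - 1) (fun i _ => Nat.zero_le _)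
        (Finset.mem_univ i₀)
      have h2 := hk i₀
      omega
    omega
  have hcard2' : (2 : ℝ) ≤ Fintype.card (Eqn k) := by exact_mod_cast hcard2
  have hp1 : 1 ≤ p := by rw [hp]; linarith
  have hpP : p ≤ P * n := by rw [hp, hP]; nlinarith
  have hppκ : p * (p * κ) ≤ 1 / 2 := by
    have h1 : p ^ 2 ≤ (P * n) ^ 2 := by gcongr
    have h2 : (n : ℝ) ^ 3 / (n : ℝ) ^ ν ≤ 1 / n := by
      rw [div_le_div_iff₀ (by positivity) hn0]
      calc (n : ℝ) ^ 3 * n ≤ (n : ℝ) ^ 3 * n * n := le_mul_of_one_le_right (by positivity) hn1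
        _ = (n : ℝ) ^ 5 := by ring
        _ ≤ _ := by linarith
    calc p * (p * κ) = p ^ 2 * κ := by ring
      _ ≤ (P * n) ^ 2 * κ := by gcongr
      _ = P ^ 2 * D * ((n : ℝ) ^ 3 / (n : ℝ) ^ ν) := by rw [hκ]; field_simp
      _ ≤ P ^ 2 * D * (1 / n) := by gcongr
      _ ≤ 1 / 2 := by
          rw [mul_one_div, div_le_iff₀ hn0]; linarith
  have hpκ : p * κ < 1 := by
    have : 0 ≤ p * κ := by positivity
    nlinarith
  obtain ⟨hG0, hmain⟩ := abs_gaussianFormula_sub_vol_le hcenter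
    (halfSq_section_pos hδ hν2 hk (fun i => (hab i).2) fun J => (hz J).1) hκ0
    (columnForm_section_sq_le ha hδ hν2 hk hab hz) hcard2 hp hpκ
  -- The left side is D^{3/2} n^{(3-ν)/2}, and (3 - ν)/2 ≤ -1 for ν ≥ 5.
  have hκ3 : (n : ℝ) ^ ν * Real.sqrt κ ^ 3 ≤ Real.sqrt (D ^ 3) / n := by
    rw [← sq_le_sq₀ (by positivity) (by positivity), div_pow, Real.sq_sqrt (by positivity)]
    calc ((n : ℝ) ^ ν * Real.sqrt κ ^ 3) ^ 2 = ((n : ℝ) ^ ν) ^ 2 * (Real.sqrt κ ^ 2) ^ 3 := by ring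
      _ = D ^ 3 * ((n : ℝ) ^ 3 / (n : ℝ) ^ ν) := by
          rw [Real.sq_sqrt hκ0.le, hκ]
          field_simp
      _ ≤ D ^ 3 * (1 / (n : ℝ) ^ 2) := by
          refine mul_le_mul_of_nonneg_left ?_ (by positivity)
          rw [div_le_div_iff₀ (by positivity) (by positivity), one_mul, ← pow_add]
          exact hpow
      _ = D ^ 3 / (n : ℝ) ^ 2 := by rw [mul_one_div]
  have herr : (Fintype.card (Cell k) : ℝ) *
      ((1 - p * κ) ^ (-p) * (12 * Real.exp (1 / 4) * Real.sqrt κ ^ 3)) ≤ η := by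
    have h1 : (Fintype.card (Cell k) : ℝ) ≤ b ^ ν * (n : ℝ) ^ ν := by
      rw [card_cell]
      push_cast
      exact prod_size_le_pow fun i => (hab i).2
    calc _ ≤ (b ^ ν * (n : ℝ) ^ ν) * (2 * (12 * Real.exp (1 / 4) * Real.sqrt κ ^ 3)) := by
          gcongr
          exact one_sub_rpow_neg_le_two hp1 (by positivity) hppκ
      _ = b ^ ν * (2 * (12 * Real.exp (1 / 4))) * ((n : ℝ) ^ ν * Real.sqrt κ ^ 3) := by ring
      _ ≤ b ^ ν * (2 * (12 * Real.exp (1 / 4))) * (Real.sqrt (D ^ 3) / n) := by gcongr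
      _ = E / n := by rw [hE]; ring
      _ ≤ η := by
          rw [div_le_iff₀ hn0]
          rw [div_le_iff₀ hη0] at hnn₂
          linarith
  rw [card_cell, hcard] at hmain
  change |gaussianFormula (sectionMatrix k) z -
    vol ((∏ i, k i) - ((∑ i, (k i - 1)) + 1)) (transportPolytope k N β)| ≤ _ at hmain
  rw [card_cell] at herr
  set G := gaussianFormula (sectionMatrix k) z
  set v := vol ((∏ i, k i) - ((∑ i, (k i - 1)) + 1)) (transportPolytope k N β)
  have h1 : |G - v| ≤ η * G := hmain.trans (mul_le_mul_of_nonneg_right herr hG0)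
  have h2 : G - v ≤ η * G := (le_abs_self _).trans h1
  have hη1 : η * (1 + ε) = ε := by rw [hη]; field_simp
  have h3 : G ≤ (1 + ε) * v := by nlinarith
  calc |G - v| ≤ η * G := h1
    _ ≤ η * ((1 + ε) * v) := by gcongr
    _ = ε * v := by rw [← mul_assoc, hη1]

end Main

/-! ### Polystochastic tensors. -/

section Polystochastic

variable {ν : ℕ}

/-- The last sectional sum in each direction is the total minus the k - 1 others. -/
theorem transportPolytope_eq_polystochastic (hν : 2 ≤ ν) {k : ℕ} (hk : 1 < k) :
    transportPolytope (fun _ : Fin ν => k) ((k : ℝ) ^ ν) (fun _ _ => (k : ℝ) ^ (ν - 1)) =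
      polystochastic ν k := by
  have hsec : ∀ (x : EuclideanSpace ℝ (Fin ν → Fin k)) (i : Fin ν) (j : Fin k),
      ∑ J ∈ Finset.univ.filter (fun J : Fin ν → Fin k => J i = j), x J =
        ∑ J : Fin ν → Fin k, (if J i = j then 1 else 0) * x J := by
    intro x i j
    rw [Finset.sum_filter]
    exact Finset.sum_congr rfl fun J _ => by split_ifs <;> simp
  have htot : ∀ (x : EuclideanSpace ℝ (Fin ν → Fin k)) (i : Fin ν),
      ∑ j, ∑ J ∈ Finset.univ.filter (fun J : Fin ν → Fin k => J i = j), x J =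
        ∑ J, x J := fun x i =>
    Finset.sum_fiberwise Finset.univ (fun J : Fin ν → Fin k => J i) (fun J => x J)
  have hpow : (k : ℝ) ^ ν = k * (k : ℝ) ^ (ν - 1) := by
    rw [← pow_succ']
    congr 1
    omega
  ext x
  constructor
  · rintro ⟨h1, h2⟩
    refine ⟨h2, fun i j => ?_⟩
    have hnonlast : ∀ j : Fin k, (j : ℕ) + 1 < k →
        ∑ J ∈ Finset.univ.filter (fun J : Fin ν → Fin k => J i = j), x J = (k : ℝ) ^ (ν - 1) := by
      intro j hj
      rw [hsec]
      exact h1 (some ⟨i, ⟨j, hj⟩⟩)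
    by_cases hj : (j : ℕ) + 1 < k
    · exact hnonlast j hj
    · have hsum := htot x i
      have hN : ∑ J, x J = (k : ℝ) ^ ν := by
        have := h1 none
        simpa [sectionMatrix, sectionRhs] using this
      rw [hN, ← Finset.add_sum_erase _ _ (Finset.mem_univ j)] at hsum
      have hrest : ∑ j' ∈ Finset.univ.erase j,
          ∑ J ∈ Finset.univ.filter (fun J : Fin ν → Fin k => J i = j'), x J =
          ((k : ℝ) - 1) * (k : ℝ) ^ (ν - 1) := by
        rw [Finset.sum_congr rfl fun j' hj' => hnonlast j' ?_]
        · rw [Finset.sum_const, Finset.card_erase_of_mem (Finset.mem_univ j), Finset.card_univ,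
            Fintype.card_fin, nsmul_eq_mul, Nat.cast_pred (by omega)]
        · have h3 : (j' : ℕ) ≠ j := fun h => Finset.ne_of_mem_erase hj' (Fin.ext h)
          have := j'.2
          have := j.2
          omega
      rw [hrest, hpow] at hsum
      linarith
  · rintro ⟨h1, h2⟩
    refine ⟨fun r => ?_, h1⟩
    rcases r with _ | ⟨i, j⟩
    · let i₀ : Fin ν := ⟨0, by omega⟩
      have := htot x i₀
      rw [Finset.sum_congr rfl fun j _ => h2 i₀ j] at this
      simp only [sectionMatrix, Matrix.of_apply, one_mul, sectionRhs]
      rw [← this, hpow]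
      simp
    · have := h2 i j.1
      rw [hsec] at this
      exact this

/-- Use ln x ≤ x - 1; the entries sum to k^ν, so ∑ (x_J - 1) = 0. -/
theorem isAnalyticCenter_polystochastic (hν : 2 ≤ ν) {k : ℕ} (hk : 1 < k) :
    IsAnalyticCenter (polystochastic ν k) (WithLp.toLp 2 fun _ => 1) := by
  have hpow : (k : ℝ) ^ ν = k * (k : ℝ) ^ (ν - 1) := by
    rw [← pow_succ']
    congr 1
    omega
  have hk0 : (k : ℝ) ≠ 0 := by positivity
  refine ⟨⟨fun J => zero_le_one, fun i j => ?_⟩, fun J => zero_lt_one, fun x hx hpos => ?_⟩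
  · have h1 := sum_pi_comp_eval (α := fun _ : Fin ν => Fin k) i
      (fun j' => if j' = j then (1 : ℝ) else 0)
    simp only [Fintype.card_fin, Finset.prod_const, Finset.card_univ, Finset.sum_ite_eq',
      Finset.mem_univ, if_true, mul_one, hpow] at h1
    rw [Finset.sum_filter]
    exact mul_left_cancel₀ hk0 h1
  · have hN : ∑ J, x J = (k : ℝ) ^ ν := by
      rw [← transportPolytope_eq_polystochastic hν hk] at hx
      have := hx.1 none
      simpa [sectionMatrix, sectionRhs] using this
    unfold entropy
    simp only [Real.log_one, Finset.sum_const_zero, add_zero, add_le_iff_nonpos_right]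
    calc ∑ J, Real.log (x J) ≤ ∑ J, (x J - 1) :=
          Finset.sum_le_sum fun J _ => Real.log_le_sub_one_of_pos (hpos J)
      _ = 0 := by
          rw [Finset.sum_sub_distrib, hN]
          simp

theorem gaussianFormula_one (hν : 2 ≤ ν) {k : ℕ} (hk : 1 < k) :
    gaussianFormula (sectionMatrix fun _ : Fin ν => k) (WithLp.toLp 2 fun _ => 1) =
      Real.exp ((k : ℝ) ^ ν) / (2 * Real.pi) ^ (((ν : ℝ) * k - ν + 1) / 2) := by
  set A := sectionMatrix fun _ : Fin ν => k with hA
  have hB : scaledMatrix A (WithLp.toLp 2 fun _ => 1) = A := by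
    ext r J
    simp [scaledMatrix]
  have hdet : (A * Aᵀ).det ≠ 0 := by
    refine (det_mul_transpose_pos_of_halfSq_pos (z := WithLp.toLp 2 fun _ => 1)
      (halfSq_section_pos (δ := 1) (b := 1) (n := k) one_pos hν (fun _ => hk) (by simp)
        fun J => le_rfl)).ne'
  rw [gaussianFormula, hB, div_self hdet, Real.sqrt_one, mul_one, card_eqn]
  have h1 : entropy (WithLp.toLp 2 fun _ : Cell (fun _ : Fin ν => k) => (1 : ℝ)) =
      (k : ℝ) ^ ν := by
    simp [entropy]
  have h2 : (((∑ _i : Fin ν, (k - 1)) + 1 : ℕ) : ℝ) = (ν : ℝ) * k - ν + 1 := by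
    simp only [Finset.sum_const, Finset.card_univ, Fintype.card_fin, smul_eq_mul]
    push_cast [Nat.cast_pred (show 0 < k by omega)]
    ring
  rw [h1, h2]
  ring

theorem tendsto_vol_polystochastic (hν : 5 ≤ ν) :
    Tendsto (fun k : ℕ =>
      vol (k ^ ν - (ν * (k - 1) + 1)) (polystochastic ν k) /
        (Real.exp ((k : ℝ) ^ ν) / (2 * Real.pi) ^ (((ν : ℝ) * k - ν + 1) / 2)))
      atTop (𝓝 1) := by
  rw [Metric.tendsto_atTop]
  intro ε hε
  -- With ε/(2 + ε) the error relative to the volume becomes ε/2 relative to the formula, which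
  -- leaves a strict inequality.
  obtain ⟨n₀, hn₀⟩ := exists_gaussianFormula_error_le hν (a := 1) (b := 1) (δ := 1) (Δ := 1)
    one_pos one_pos (ε := ε / (2 + ε)) (by positivity)
  refine ⟨max n₀ 2, fun k hk => ?_⟩
  have hk1 : 1 < k := lt_of_lt_of_le one_lt_two ((le_max_right _ _).trans hk)
  have hν2 : 2 ≤ ν := by omega
  have h := hn₀ k (fun _ => k) ((k : ℝ) ^ ν) (fun _ _ => (k : ℝ) ^ (ν - 1))
    (WithLp.toLp 2 fun _ => 1) ((le_max_left _ _).trans hk) (fun _ => hk1) (by simp)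
    (by rw [transportPolytope_eq_polystochastic hν2 hk1]
        exact isAnalyticCenter_polystochastic hν2 hk1) fun J => ⟨le_rfl, le_rfl⟩
  rw [transportPolytope_eq_polystochastic hν2 hk1, gaussianFormula_one hν2 hk1] at h
  simp only [Finset.prod_const, Finset.sum_const, Finset.card_univ, Fintype.card_fin,
    smul_eq_mul] at h
  set G : ℝ := Real.exp ((k : ℝ) ^ ν) / (2 * Real.pi) ^ (((ν : ℝ) * k - ν + 1) / 2) with hG
  have hG0 : 0 < G := by positivity
  set v := vol (k ^ ν - (ν * (k - 1) + 1)) (polystochastic ν k)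
  rw [Real.dist_eq, show v / G - 1 = (v - G) / G by field_simp, abs_div, abs_of_pos hG0,
    div_lt_iff₀ hG0, abs_sub_comm]
  have h1 : v - G ≤ ε / (2 + ε) * v := by
    have := (neg_abs_le (G - v))
    linarith
  have h2 : v ≤ (2 + ε) / 2 * G := by
    have h3 : ε / (2 + ε) * v = v - 2 / (2 + ε) * v := by field_simp; ring
    rw [h3] at h1
    have h4 : 2 / (2 + ε) * v ≤ G := by linarith
    rw [div_mul_eq_mul_div, div_le_iff₀ (by positivity)] at h4
    linarith
  calc |G - v| ≤ ε / (2 + ε) * v := h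
    _ ≤ ε / (2 + ε) * ((2 + ε) / 2 * G) := by gcongr
    _ = ε / 2 * G := by field_simp
    _ < ε * G := by nlinarith

end Polystochastic

end GaussVol

end

theorem mainTheorem8 (ν : ℕ) (hν : 2 ≤ ν) :
    -- the smallest eigenvalue of `q` is of the order `n ^ (ν - 2)`
    (∀ a b δ Δ : ℝ, 0 < a → 0 < δ →
      ∃ c C : ℝ, 0 < c ∧ 0 < C ∧
        ∀ (n : ℕ) (k : Fin ν → ℕ) (N : ℝ) (β : (i : Fin ν) → Fin (k i) → ℝ)
          (z : EuclideanSpace ℝ (GaussVol.Cell k)),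
          (∀ i, 1 < k i) → (∀ i, a * n ≤ k i ∧ (k i : ℝ) ≤ b * n) →
          (∀ i j, 0 < β i j) → (∀ i, ∑ j, β i j = N) →
          GaussVol.IsAnalyticCenter (GaussVol.transportPolytope k N β) z →
          (∀ J, δ ≤ z J ∧ z J ≤ Δ) →
          ∃ l : ℝ,
            GaussVol.IsSmallestEigenvalue (GaussVol.momentForm (GaussVol.sectionMatrix k) z) l ∧
            c * (n : ℝ) ^ (ν - 2) ≤ l ∧ l ≤ C * (n : ℝ) ^ (ν - 2)) ∧
    -- for `ν ≥ 5` the relative error of the Gaussian formula tends to `0`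
    (5 ≤ ν → ∀ a b δ Δ : ℝ, 0 < a → 0 < δ →
      ∀ ε : ℝ, 0 < ε → ∃ n₀ : ℕ,
        ∀ (n : ℕ) (k : Fin ν → ℕ) (N : ℝ) (β : (i : Fin ν) → Fin (k i) → ℝ)
          (z : EuclideanSpace ℝ (GaussVol.Cell k)),
          n₀ ≤ n →
          (∀ i, 1 < k i) → (∀ i, a * n ≤ k i ∧ (k i : ℝ) ≤ b * n) →
          (∀ i j, 0 < β i j) → (∀ i, ∑ j, β i j = N) →
          GaussVol.IsAnalyticCenter (GaussVol.transportPolytope k N β) z →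
          (∀ J, δ ≤ z J ∧ z J ≤ Δ) →
          |GaussVol.gaussianFormula (GaussVol.sectionMatrix k) z -
              GaussVol.vol ((∏ i, k i) - ((∑ i, (k i - 1)) + 1)) (GaussVol.transportPolytope k N β)| ≤
            ε * GaussVol.vol ((∏ i, k i) - ((∑ i, (k i - 1)) + 1))
              (GaussVol.transportPolytope k N β)) ∧
    -- polystochastic tensors
    (∀ k : ℕ, 1 < k →
      GaussVol.IsAnalyticCenter (GaussVol.polystochastic ν k) (WithLp.toLp 2 fun _ => 1)) ∧
    (5 ≤ ν →
      Tendsto (fun k : ℕ =>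
        GaussVol.vol (k ^ ν - (ν * (k - 1) + 1)) (GaussVol.polystochastic ν k) /
          (Real.exp ((k : ℝ) ^ ν) / (2 * Real.pi) ^ (((ν : ℝ) * k - ν + 1) / 2)))
        atTop (𝓝 1)) := by
  refine ⟨fun a b δ Δ ha hδ => ?_, fun hν5 a b δ Δ ha hδ ε hε => ?_, fun k hk =>
    GaussVol.isAnalyticCenter_polystochastic hν hk, GaussVol.tendsto_vol_polystochastic⟩
  -- The terms b² + 1, |b| and the final + 1 keep both constants positive for every real b and Δ,
  -- including values for which the class is empty.
  · refine ⟨δ ^ 2 * a ^ ν / (2 * (ν + 3) * (b ^ 2 + 1)), Δ ^ 2 * |b| ^ ν / (2 * a ^ 2) + 1,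
      by positivity, by positivity, ?_⟩
    intro n k N β z hk hab _ _ _ hz
    exact GaussVol.exists_smallest_eigenvalue_bounds hν ha hδ hk hab hz
  · obtain ⟨n₀, h⟩ := GaussVol.exists_gaussianFormula_error_le hν5 (b := b) (Δ := Δ) ha hδ hε
    exact ⟨n₀, fun n k N β z hn hk hab _ _ hc hz => h n k N β z hn hk hab hc hz⟩
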